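/- Let $n\in\mathbb{N}$ and let $\mathbb{CH}^n=\mathbb{B}^n=\{z\in\mathbb{C}^n:|z|<1\}$, with $\operatorname{Aut}(\mathbb{B}^n)$ the group of biholomorphic self-maps. A *complex geodesic* is the image under an element of $\operatorname{Aut}(\mathbb{B}^n)$ of the slice $\{(z,0,\dots,0):|z|<1\}$. Let $Y=(y_1,y_2,y_3)$ be an ordered triple of distinct points of $\mathbb{CH}^n$. *Normal form.* Let $\mathcal N$ be the set of triples $X=(x_1,x_2,x_3)=((0,0),(s,0),(w,t))$ in $\mathbb{B}^2$ with $s>0$, $t\ge 0$, $w\in\mathbb{C}$, and $\mathcal E=\{X\in\mathcal N:t=0\}$. A normal form of $Y$ is a triple $X\in\mathcal N$ such that some $\Phi\in\operatorname{Aut}(\mathbb{B}^n)$ has $\Phi(y_j)=x_j$ for $j=1,2,3$, where points of $\mathbb{B}^n$ and $\mathbb{B}^2$ are identified if their coordinates, continued by zeros, agree. $Y$ has exactly one normal form; denote it by $X$. *The space.* Let $DA_2$ be the reproducing kernel Hilbert space on $\mathbb{B}^2$ with kernel functions $k_w(z)=(1-(z,w))^{-1}$, $(z,w)=\sum_i z_i\overline{w_i}$.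 Let $H=DA_2(X)$ be the span in $DA_2$ of $k_i=k_{x_i}$, $i=1,2,3$, regarded as a space of functions on $X$, and put $k_{ij}=\langle k_i,k_j\rangle=k_{x_i}(x_j)$, $$\delta_{ij}=\Bigl(1-\frac{|k_{ij}|^2}{k_{ii}k_{jj}}\Bigr)^{1/2},\qquad LF_{123}^2=\frac1{\delta_{12}^2}\left|1-\frac{k_{21}k_{13}}{k_{23}k_{11}}\right|^2 .$$ A multiplier of $H$ is a function $m:X\to\mathbb{C}$ for which $(M_mh)(x)=m(x)h(x)$ defines a bounded operator $M_m$ on $H$; $\|m\|$ is the operator norm of $M_m$. Put $$\Delta_G=\sup\{\operatorname{Re}m(x_1): m(x_2)=m(x_3)=0,\ \|m\|\le 1\},$$ $$\Delta_H=\|k_1\|^{-1}\sup\{\operatorname{Re}h(x_1):h\in H,\ h(x_2)=h(x_3)=0,\ \|h\|\le1\}.$$ *Extremal multipliers.* Each of the following multipliers of norm one exists and is unique: for $i=2,3$, the multiplier $M_i$ that vanishes at $x_1$ and maximizes $\operatorname{Re}M_i(x_i)$ among the multipliers of norm one that vanish at $x_1$; for $i=2,3$, the multiplier $m_i$ that vanishes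 at $x_i$ and maximizes $\operatorname{Re}m_i(x_1)$ among those that vanish at $x_i$; the multiplier $m_{23}$ that vanishes at $x_2$ and $x_3$ and maximizes $\operatorname{Re}m_{23}(x_1)$ among those that vanish at $x_2$ and $x_3$. **Proposition.** With this notation the following are equivalent: 1. the points of $Y$ lie in a single complex geodesic; 2. $X\in\mathcal E$; 3. $LF_{123}^2=\delta_{13}^2$; 4. $M_2=\alpha M_3$ for some $\alpha\in\mathbb{C}$ with $|\alpha|=1$; 5. $m_{23}=m_2m_3$; 6. $\|m_2m_3\|=1$; 7. $\Delta_G=\delta_{12}\delta_{13}$; 8. $\Delta_H=\delta_{12}\delta_{13}$. -/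

import Mathlib

noncomputable section

open scoped ComplexOrder

namespace DruryArveson

/-! ## The ball model of complex hyperbolic space -/

/-- Complex hyperbolic `n`-space: the open unit ball of `ℂⁿ` with its Euclidean norm. -/
abbrev Ball (n : ℕ) : Type := ↥(Metric.ball (0 : EuclideanSpace ℂ (Fin n)) 1)

/-- A map between balls is holomorphic if it is the restriction of a map that is
complex differentiable on the open ball. -/
def IsHolomorphicMap {n : ℕ} (f : Ball n → Ball n) : Prop :=
  ∃ F : EuclideanSpace ℂ (Fin n) → EuclideanSpace ℂ (Fin n),
    DifferentiableOn ℂ F (Metric.ball 0 1) ∧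
      ∀ z : Ball n, F (z : EuclideanSpace ℂ (Fin n)) = (f z : EuclideanSpace ℂ (Fin n))

/-- `Φ ∈ Aut(𝔹ⁿ)`: a biholomorphic self-map of the ball. -/
def IsBallAut {n : ℕ} (Φ : Ball n ≃ Ball n) : Prop :=
  IsHolomorphicMap Φ ∧ IsHolomorphicMap Φ.symm

/-- The model complex geodesic `{(z, 0, …, 0) : |z| < 1}`. -/
def horizontalSlice (n : ℕ) : Set (Ball n) :=
  {z | ∀ i : Fin n, (i : ℕ) ≠ 0 → (z : EuclideanSpace ℂ (Fin n)) i = 0}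

/-- Complex geodesics: the images of the model one under the automorphism group. -/
def IsComplexGeodesic {n : ℕ} (G : Set (Ball n)) : Prop :=
  ∃ Φ : Ball n ≃ Ball n, IsBallAut Φ ∧ G = Φ '' horizontalSlice n

/-! ## Normal forms of triples -/

/-- The `i`-th coordinate (counted from `0`) of a point of the ball,
the coordinates being continued by zero. -/
def coord {n : ℕ} (z : Ball n) (i : ℕ) : ℂ :=
  if h : i < n then (z : EuclideanSpace ℂ (Fin n)) ⟨i, h⟩ else 0

/-- The triple is `(0,0), (s,0), (w,t)`. -/
def HasNormalCoords (x : Fin 3 → Ball 2) (s t : ℝ) (w : ℂ) : Prop :=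
  (x 0 : EuclideanSpace ℂ (Fin 2)) = !₂[0, 0] ∧
  (x 1 : EuclideanSpace ℂ (Fin 2)) = !₂[(s : ℂ), 0] ∧
  (x 2 : EuclideanSpace ℂ (Fin 2)) = !₂[w, (t : ℂ)]

/-- The class `𝒩` of triples in normal form. -/
def ClassN (x : Fin 3 → Ball 2) : Prop :=
  ∃ (s t : ℝ) (w : ℂ), 0 < s ∧ 0 ≤ t ∧ HasNormalCoords x s t w

/-- The class `ℰ`: triples in normal form with `t = 0`. -/
def ClassE (x : Fin 3 → Ball 2) : Prop :=
  ∃ (s : ℝ) (w : ℂ), 0 < s ∧ HasNormalCoords x s 0 w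

/-- `x` is the normal form of the ordered triple `y` in `ℂℍⁿ`: it lies in `𝒩`, and some
automorphism of the ball `𝔹ⁿ` carries `y` to `x`. A point of `𝔹ⁿ` and a point of `𝔹²` are
identified when their coordinates agree after continuation by zero. -/
def IsNormalFormOf {n : ℕ} (x : Fin 3 → Ball 2) (y : Fin 3 → Ball n) : Prop :=
  ClassN x ∧ ∃ Φ : Ball n ≃ Ball n, IsBallAut Φ ∧ ∀ j i, coord (Φ (y j)) i = coord (x j) i

/-! ## The Drury–Arveson space -/

/-- The kernel `k_w(z) = (1 - (z, w))⁻¹`, where `(z, w) = ∑ zᵢ conj wᵢ`, as an operator-valued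
kernel with entry `(z, w)` equal to multiplication by `k_w(z)`. -/
def kernelMatrix (n : ℕ) : Matrix (Ball n) (Ball n) (ℂ →L[ℂ] ℂ) :=
  Matrix.of fun z w =>
    (1 - inner ℂ (w : EuclideanSpace ℂ (Fin n)) (z : EuclideanSpace ℂ (Fin n)))⁻¹ •
      ContinuousLinearMap.id ℂ ℂ

theorem norm_inner_lt_one {n : ℕ} (z w : Ball n) :
    ‖inner ℂ (w : EuclideanSpace ℂ (Fin n)) (z : EuclideanSpace ℂ (Fin n))‖ < 1 := by
  have hz : ‖(z : EuclideanSpace ℂ (Fin n))‖ < 1 := mem_ball_zero_iff.1 z.2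
  have hw : ‖(w : EuclideanSpace ℂ (Fin n))‖ < 1 := mem_ball_zero_iff.1 w.2
  calc _ ≤ _ := norm_inner_le_norm _ _
    _ < 1 := mul_lt_one_of_nonneg_of_lt_one_left (norm_nonneg _) hw hz.le

theorem posSemidef_gram_pow {n : ℕ} {κ : Type*} [Fintype κ] (p : κ → Ball n) (m : ℕ) :
    (Matrix.of fun a b => (inner ℂ (p b : EuclideanSpace ℂ (Fin n))
      (p a : EuclideanSpace ℂ (Fin n))) ^ m : Matrix κ κ ℂ).PosSemidef := by
  classical
  induction m with
  | zero =>
    have h := Matrix.posSemidef_vecMulVec_self_star (fun _ : κ => (1 : ℂ))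
    convert h using 1
    ext a b
    simp [Matrix.vecMulVec]
  | succ m ih =>
    have h := (Matrix.posSemidef_gram ℂ
      (fun a : κ => (p a : EuclideanSpace ℂ (Fin n)))).transpose
    have e := ih.hadamard h
    refine Eq.subst (motive := Matrix.PosSemidef) ?_ e
    ext a b
    simp [pow_succ]

theorem kernelMatrix_posSemidef (n : ℕ) : (kernelMatrix n).PosSemidef := by
  have tf := (RKHS.posSemidef_tfae (K := kernelMatrix n)).out 0 2
  refine tf.mpr ⟨?_, fun v => ?_⟩
  · ext1 z w
    simp only [kernelMatrix, Matrix.conjTranspose_apply, Matrix.of_apply, star_smul, star_inv₀,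
      star_sub, star_one]
    congr 1
    · simp
    · exact ContinuousLinearMap.adjoint_id
  · have key : ∀ z w : Ball n, HasSum
        (fun m : ℕ => (starRingEnd ℂ (v z)) * (inner ℂ (w : EuclideanSpace ℂ (Fin n))
          (z : EuclideanSpace ℂ (Fin n))) ^ m * v w)
        (inner ℂ (kernelMatrix n w z (v z)) (v w)) := by
      intro z w
      have h := ((hasSum_geometric_of_norm_lt_one (norm_inner_lt_one z w)).mul_left
        (starRingEnd ℂ (v z))).mul_right (v w)
      have e : inner ℂ (kernelMatrix n w z (v z)) (v w) =
          (starRingEnd ℂ) (v z) * (1 - inner ℂ (w : EuclideanSpace ℂ (Fin n))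
            (z : EuclideanSpace ℂ (Fin n)))⁻¹ * v w := by
        simp [kernelMatrix]
        ring
      rw [e]
      exact h
    have tot : HasSum (fun m : ℕ => ∑ z ∈ v.support, ∑ w ∈ v.support,
        (starRingEnd ℂ (v z)) * (inner ℂ (w : EuclideanSpace ℂ (Fin n))
          (z : EuclideanSpace ℂ (Fin n))) ^ m * v w)
        (v.sum fun z a => v.sum fun w b => inner ℂ (kernelMatrix n w z a) b) :=
      hasSum_sum fun z _ => hasSum_sum fun w _ => key z w
    have hre := Complex.hasSum_re tot
    refine hre.nonneg fun m => ?_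
    have h := (posSemidef_gram_pow (fun a : v.support => (a : Ball n)) m).dotProduct_mulVec_nonneg
      (fun a => v a)
    have h2 := (Complex.nonneg_iff.1 h).1
    refine h2.trans_eq (congrArg Complex.re ?_)
    simp only [dotProduct, Matrix.mulVec, Finset.mul_sum, Pi.star_apply, Matrix.of_apply]
    rw [← Finset.sum_coe_sort v.support]
    refine Finset.sum_congr rfl fun a _ => ?_
    rw [← Finset.sum_coe_sort v.support]
    refine Finset.sum_congr rfl fun b _ => ?_
    simp [mul_assoc]

instance (n : ℕ) : Fact (kernelMatrix n).PosSemidef := ⟨kernelMatrix_posSemidef n⟩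

/-- The Drury–Arveson space `DA_n`: the reproducing kernel Hilbert space of functions on the
ball with kernel `k_w(z) = (1 - (z, w))⁻¹`. -/
abbrev DA (n : ℕ) : Type := RKHS.OfKernel (kernelMatrix n)

/-- The reproducing kernel function `k_w ∈ DA_n`. -/
def kerVec {n : ℕ} (w : Ball n) : DA n := RKHS.kerFun (DA n) w 1

theorem kerVec_apply {n : ℕ} (w z : Ball n) :
    kerVec w z = (1 - inner ℂ (w : EuclideanSpace ℂ (Fin n)) (z : EuclideanSpace ℂ (Fin n)))⁻¹ := by
  rw [kerVec, RKHS.kerFun_apply, RKHS.OfKernel.kernel_ofKernel]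
  simp [kernelMatrix]

/-- For a family `X = {x_i}` in the ball, `DA_n(X)` is the span of the kernel functions
`k_{x_i}` in `DA_n`, with the norm of `DA_n`. Its elements are regarded as functions on `X`. -/
def DASub {ι : Type*} {n : ℕ} (x : ι → Ball n) : Submodule ℂ (DA n) :=
  Submodule.span ℂ (Set.range fun i => kerVec (x i))

section Invariants

variable {ι : Type*} {n : ℕ} (x : ι → Ball n)

/-- The Gram matrix entry `k_ij = ⟨k_i, k_j⟩ = k_{x_i}(x_j)`. The inner product of Mathlib is
linear in its second argument. -/
def gram (i j : ι) : ℂ := inner ℂ (kerVec (x j)) (kerVec (x i))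

/-- The metric `δ_ij = (1 - |k_ij|² / (k_ii k_jj))^{1/2}`. -/
def delta (i j : ι) : ℝ :=
  Real.sqrt (1 - ‖gram x i j‖ ^ 2 / ((gram x i i).re * (gram x j j).re))

/-- `LF_ijl² = δ_ij⁻² |1 - k_ji k_il / (k_jl k_ii)|²`. -/
def LFsq (i j l : ι) : ℝ :=
  1 / delta x i j ^ 2 *
    ‖1 - gram x j i * gram x i l / (gram x j l * gram x i i)‖ ^ 2

/-- A multiplier of `DA_n(X)`: a symbol function `m` on `X` with its multiplier operator `M_m`,
`(M_m h)(x) = m(x) h(x)`. -/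
@[ext]
structure Multiplier where
  /-- The symbol function. -/
  symbol : ι → ℂ
  /-- The multiplier operator. -/
  op : DASub x →L[ℂ] DASub x
  op_apply : ∀ (h : DASub x) (i : ι), (op h : DA n) (x i) = symbol i * (h : DA n) (x i)

variable {x}

/-- The norm of the multiplier algebra is the operator norm. -/
instance : Norm (Multiplier x) := ⟨fun m => ‖m.op‖⟩

instance : Mul (Multiplier x) :=
  ⟨fun m m' => ⟨fun i => m.symbol i * m'.symbol i, m.op ∘L m'.op, fun h i => by
    simp [m.op_apply, m'.op_apply, mul_assoc]⟩⟩

instance : SMul ℂ (Multiplier x) :=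
  ⟨fun c m => ⟨fun i => c * m.symbol i, c • m.op, fun h i => by
    simp [m.op_apply, mul_assoc]⟩⟩

/-- `m` is a multiplier of norm one that vanishes at the points with index in `Z` and that
maximizes `Re m(x_a)` among all such multipliers. -/
def IsExtremal (Z : Set ι) (a : ι) (m : Multiplier x) : Prop :=
  (‖m‖ = 1 ∧ ∀ z ∈ Z, m.symbol z = 0) ∧
    ∀ m' : Multiplier x, (‖m'‖ = 1 ∧ ∀ z ∈ Z, m'.symbol z = 0) →
      (m'.symbol a).re ≤ (m.symbol a).re

variable (x)

/-- `Δ_G(x_a; x_b, x_c)`, the extremal value for the multiplier algebra. -/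
def DeltaG (a b c : ι) : ℝ :=
  sSup {r | ∃ m : Multiplier x, m.symbol b = 0 ∧ m.symbol c = 0 ∧ ‖m‖ ≤ 1 ∧
    r = (m.symbol a).re}

/-- `Δ_H(x_a; x_b, x_c)`, the extremal value for the Hilbert space `H = DA_n(X)`. -/
def DeltaH (a b c : ι) : ℝ :=
  1 / ‖kerVec (x a)‖ *
    sSup {r | ∃ h : DASub x, (h : DA n) (x b) = 0 ∧ (h : DA n) (x c) = 0 ∧ ‖h‖ ≤ 1 ∧
      r = ((h : DA n) (x a)).re}

end Invariants

end DruryArveson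

end

open DruryArveson

/-
After `x₁` is moved to the centre by a Möbius map `φ`, complex geodesics through it are linear, so
the three points lie in one of them iff `u = φ(x₂)` and `w = φ(x₃)` satisfy `|⟨u, w⟩| = |u| |w|`.
An automorphism fixing the centre preserves inner products (Schwarz lemma), hence this condition is
invariant, and a normal form can be read off from the Gram matrix of `u` and `w`. Each of the eight
conditions is equivalent to it.

Everything follows from `⟨φ_p w, φ_p z⟩ = 1 - k_w(p) k_p(z) / (k_p(p) k_w(z))`. It expresses `δ`
and `LF` through `u` and `w`, and it is the complete Pick property of the kernel: the extremal
multiplier vanishing at `p` and maximal at `q` is `⟨φ_p q, φ_p(·)⟩ / |φ_p q|`. A multiplier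
vanishing at `x₂` and `x₃` is a multiple of the rank-one operator `g ⊗ k₁`, where `g ∈ H` is `1`
at `x₁` and `0` at `x₂`, `x₃`. With `N = ‖g‖ ‖k₁‖` this gives `Δ_G = Δ_H = 1 / N` and `‖m₂ m₃‖ =
δ₁₂ δ₁₃ N`, so the last four conditions all say `δ₁₂ δ₁₃ N = 1`. Finally, a Schur complement in
the `3 × 3` Gram determinant yields `N² (|u|² |w|² - (1 - δ₂₃²) |⟨u, w⟩|²) = δ₂₃²`.
-/

noncomputable section

open scoped ComplexOrder

namespace DruryArveson

theorem one_sub_norm_sq_pos {E : Type*} [SeminormedAddGroup E] {z : E} (hz : ‖z‖ < 1) :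
    0 < 1 - ‖z‖ ^ 2 :=
  sub_pos.2 (pow_lt_one₀ (norm_nonneg z) hz two_ne_zero)

section Moebius

variable {E : Type*} [NormedAddCommGroup E] [InnerProductSpace ℂ E]

/-- The involutive Möbius map of the unit ball exchanging `a` and `0`. -/
def moebius (a z : E) : E :=
  (1 - inner ℂ a z)⁻¹ •
    ((1 - inner ℂ a z / (1 + Real.sqrt (1 - ‖a‖ ^ 2))) • a - (Real.sqrt (1 - ‖a‖ ^ 2) : ℂ) • z)

/-- Three points of the unit ball lie in one complex geodesic: once `a` is moved to the centre,
where complex geodesics are linear, equality holds in the Cauchy–Schwarz inequality for the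
other two points. -/
def MoebiusCollinear (a z w : E) : Prop :=
  ‖inner ℂ (moebius a z) (moebius a w)‖ = ‖moebius a z‖ * ‖moebius a w‖

theorem moebius_zero (z : E) : moebius 0 z = -z := by
  simp [moebius]

theorem moebiusCollinear_zero_iff {z w : E} :
    MoebiusCollinear 0 z w ↔ ‖inner ℂ z w‖ = ‖z‖ * ‖w‖ := by
  simp [MoebiusCollinear, moebius_zero]

theorem inner_self_eq_ofReal (z : E) : inner ℂ z z = ((‖z‖ ^ 2 : ℝ) : ℂ) := by
  rw [inner_self_eq_norm_sq_to_K]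
  simp

theorem one_sub_inner_ne_zero {z w : E} (hz : ‖z‖ < 1) (hw : ‖w‖ < 1) : 1 - inner ℂ z w ≠ 0 := by
  intro h
  have hle := norm_inner_le_norm (𝕜 := ℂ) z w
  rw [← sub_eq_zero.1 h, norm_one] at hle
  exact hle.not_gt (mul_lt_one_of_nonneg_of_lt_one_left (norm_nonneg _) hz hw.le)

theorem one_add_sqrt_ne_zero (x : ℝ) : (1 + (Real.sqrt x : ℂ)) ≠ 0 := by
  have : (0 : ℝ) < 1 + Real.sqrt x := by positivity
  exact_mod_cast this.ne'

theorem inner_self_eq_one_sub_sqrt_sq {a : E} (ha : ‖a‖ < 1) :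
    inner ℂ a a = 1 - (Real.sqrt (1 - ‖a‖ ^ 2) : ℂ) ^ 2 := by
  rw [← Complex.ofReal_pow, Real.sq_sqrt (one_sub_norm_sq_pos ha).le, inner_self_eq_ofReal]
  simp

theorem one_sub_inner_moebius {a z w : E} (ha : ‖a‖ < 1) (hz : ‖z‖ < 1) (hw : ‖w‖ < 1) :
    1 - inner ℂ (moebius a w) (moebius a z) =
      (1 - inner ℂ a a) * (1 - inner ℂ w z) / ((1 - inner ℂ w a) * (1 - inner ℂ a z)) := by
  have hz' := one_sub_inner_ne_zero ha hz
  have hw' := one_sub_inner_ne_zero hw ha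
  have hρ := one_add_sqrt_ne_zero (1 - ‖a‖ ^ 2)
  simp only [moebius, inner_smul_left, inner_smul_right, inner_sub_left, inner_sub_right, map_inv₀,
    map_sub, map_one, map_div₀, map_add, Complex.conj_ofReal, inner_conj_symm]
  rw [inner_self_eq_one_sub_sqrt_sq ha]
  generalize (Real.sqrt (1 - ‖a‖ ^ 2) : ℂ) = ρ at *
  field_simp
  ring

theorem norm_moebius_lt_one {a z : E} (ha : ‖a‖ < 1) (hz : ‖z‖ < 1) : ‖moebius a z‖ < 1 := by
  have hsq : 1 - ‖moebius a z‖ ^ 2 =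
      (1 - ‖a‖ ^ 2) * (1 - ‖z‖ ^ 2) / ‖1 - inner ℂ a z‖ ^ 2 := by
    have h := one_sub_inner_moebius ha hz hz
    have hmul : (1 - inner ℂ z a) * (1 - inner ℂ a z) = ((‖1 - inner ℂ a z‖ ^ 2 : ℝ) : ℂ) := by
      rw [← Complex.normSq_eq_norm_sq, Complex.normSq_eq_conj_mul_self]
      simp
    rw [hmul] at h
    simp only [inner_self_eq_ofReal] at h
    exact_mod_cast h
  have hpos : 0 < 1 - ‖moebius a z‖ ^ 2 := by
    rw [hsq]
    exact div_pos (mul_pos (one_sub_norm_sq_pos ha) (one_sub_norm_sq_pos hz))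
      (pow_pos (norm_pos_iff.2 (one_sub_inner_ne_zero ha hz)) 2)
  exact (sq_lt_one_iff₀ (norm_nonneg _)).1 (sub_pos.1 hpos)

theorem inner_moebius {a z : E} (ha : ‖a‖ < 1) (hz : ‖z‖ < 1) :
    inner ℂ a (moebius a z) = (inner ℂ a a - inner ℂ a z) / (1 - inner ℂ a z) := by
  have hz' := one_sub_inner_ne_zero ha hz
  have hρ := one_add_sqrt_ne_zero (1 - ‖a‖ ^ 2)
  simp only [moebius, inner_smul_right, inner_sub_right]
  rw [inner_self_eq_one_sub_sqrt_sq ha]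
  field_simp
  ring

theorem moebius_moebius {a z : E} (ha : ‖a‖ < 1) (hz : ‖z‖ < 1) :
    moebius a (moebius a z) = z := by
  have hz' := one_sub_inner_ne_zero ha hz
  have ha' := one_sub_inner_ne_zero ha ha
  have hρ := one_add_sqrt_ne_zero (1 - ‖a‖ ^ 2)
  have hi : 1 - inner ℂ a (moebius a z) = (1 - inner ℂ a a) / (1 - inner ℂ a z) := by
    rw [inner_moebius ha hz]
    field_simp
    ring
  rw [moebius, hi, inner_moebius ha hz, moebius]
  rw [inner_self_eq_one_sub_sqrt_sq ha] at ha' ⊢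
  generalize (Real.sqrt (1 - ‖a‖ ^ 2) : ℂ) = ρ at *
  have hρ0 : ρ ≠ 0 := by
    rintro rfl
    simp at ha'
  match_scalars <;> field_simp <;> ring

theorem moebius_self {a : E} (ha : ‖a‖ < 1) : moebius a a = 0 := by
  have hρ := one_add_sqrt_ne_zero (1 - ‖a‖ ^ 2)
  have hcoeff : 1 - inner ℂ a a / (1 + Real.sqrt (1 - ‖a‖ ^ 2)) = Real.sqrt (1 - ‖a‖ ^ 2) := by
    rw [inner_self_eq_one_sub_sqrt_sq ha]
    field_simp
    ring
  rw [moebius, hcoeff, sub_self, smul_zero]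

theorem moebius_ne_zero {a z : E} (ha : ‖a‖ < 1) (hz : ‖z‖ < 1) (h : z ≠ a) :
    moebius a z ≠ 0 := fun h0 => h <| by
  rw [← moebius_moebius ha hz, h0, ← moebius_self ha, moebius_moebius ha ha]

theorem differentiableOn_moebius {a : E} (ha : ‖a‖ < 1) :
    DifferentiableOn ℂ (moebius a) (Metric.ball 0 1) := by
  intro z hz
  have hi : DifferentiableAt ℂ (fun z : E => inner ℂ a z) z := (innerSL ℂ a).differentiableAt
  have hz' := one_sub_inner_ne_zero ha (mem_ball_zero_iff.1 hz)
  unfold moebius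
  exact ((((differentiableAt_const _).sub hi).inv hz').smul
    ((((differentiableAt_const _).sub (hi.mul_const _)).smul_const a).sub
      (differentiableAt_id.const_smul _))).differentiableWithinAt

end Moebius

section Cartan

variable {E F : Type*} [NormedAddCommGroup E] [NormedSpace ℂ E] [NormedAddCommGroup F]
  [NormedSpace ℂ F] [StrictConvexSpace ℝ F] {f : E → F}

theorem apply_smul_of_norm_apply_eq (hf : DifferentiableOn ℂ f (Metric.ball 0 1))
    (hnorm : ∀ v ∈ Metric.ball (0 : E) 1, ‖f v‖ = ‖v‖) {v : E} (hv : v ∈ Metric.ball (0 : E) 1)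
    {c : ℂ} (hcv : c • v ∈ Metric.ball (0 : E) 1) : f (c • v) = c • f v := by
  have hzero : f 0 = 0 := by simpa using hnorm 0 (Metric.mem_ball_self one_pos)
  rcases eq_or_ne v 0 with rfl | hv0
  · simp [hzero]
  have hpos : 0 < ‖v‖ := norm_pos_iff.2 hv0
  have hdisc : ∀ c : ℂ, c ∈ Metric.ball (0 : ℂ) ‖v‖⁻¹ ↔ c • v ∈ Metric.ball (0 : E) 1 := by
    intro c
    rw [mem_ball_zero_iff, mem_ball_zero_iff, norm_smul, ← one_div, lt_div_iff₀ hpos]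
  set g : ℂ → F := fun c => f (c • v)
  have hg0 : g 0 = 0 := by simp [g, hzero]
  have hg : DifferentiableOn ℂ g (Metric.ball 0 ‖v‖⁻¹) :=
    hf.comp (differentiable_id.smul_const v).differentiableOn fun c hc => (hdisc c).1 hc
  have hmaps : Set.MapsTo g (Metric.ball 0 ‖v‖⁻¹) (Metric.closedBall (g 0) 1) := fun c hc => by
    rw [hg0, mem_closedBall_zero_iff, hnorm _ ((hdisc c).1 hc)]
    exact (mem_ball_zero_iff.1 ((hdisc c).1 hc)).le
  have hslope : dslope g 0 1 = f v := by
    rw [dslope_of_ne _ one_ne_zero, slope_def_module, hg0]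
    simp [g]
  -- Equality holds in the Schwarz lemma for `g` at the point `1`.
  have hlin := Complex.affine_of_mapsTo_ball_of_norm_dslope_eq_div hg hmaps
    ((hdisc 1).2 (by rwa [one_smul])) (by rw [hslope, hnorm v hv, one_div, inv_inv])
    ((hdisc c).2 hcv)
  simpa only [hslope, hg0, zero_add, sub_zero] using hlin

theorem eq_fderiv_of_norm_apply_eq (hf : DifferentiableOn ℂ f (Metric.ball 0 1))
    (hnorm : ∀ v ∈ Metric.ball (0 : E) 1, ‖f v‖ = ‖v‖) {v : E} (hv : v ∈ Metric.ball (0 : E) 1) :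
    f v = fderiv ℂ f 0 v := by
  have hline : HasDerivAt (fun c : ℂ => c • v) v 0 := by
    simpa using (hasDerivAt_id (0 : ℂ)).smul_const v
  have hline' : HasDerivAt (fun c : ℂ => c • f v) (f v) 0 := by
    simpa using (hasDerivAt_id (0 : ℂ)).smul_const (f v)
  have hmem : ∀ᶠ c : ℂ in nhds 0, c • v ∈ Metric.ball (0 : E) 1 :=
    (continuous_id.smul continuous_const).continuousAt.eventually_mem
      (by simpa using Metric.ball_mem_nhds (0 : E) one_pos)
  have hf0 : HasFDerivAt f (fderiv ℂ f 0) ((0 : ℂ) • v) := by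
    rw [zero_smul]
    exact (hf.differentiableAt (Metric.ball_mem_nhds _ one_pos)).hasFDerivAt
  refine (hline'.congr_of_eventuallyEq ?_).unique (hf0.comp_hasDerivAt 0 hline)
  exact hmem.mono fun c hc => apply_smul_of_norm_apply_eq hf hnorm hv hc

theorem exists_linearIsometry_eqOn_ball (hf : DifferentiableOn ℂ f (Metric.ball 0 1))
    (hnorm : ∀ v ∈ Metric.ball (0 : E) 1, ‖f v‖ = ‖v‖) :
    ∃ L : E →ₗᵢ[ℂ] F, Set.EqOn f L (Metric.ball 0 1) := by
  refine ⟨⟨(fderiv ℂ f 0).toLinearMap, fun v => ?_⟩,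
    fun v hv => eq_fderiv_of_norm_apply_eq hf hnorm hv⟩
  obtain ⟨c, hc0, hc⟩ := NormedField.exists_norm_lt ℂ (inv_pos.2 (by positivity : 0 < 1 + ‖v‖))
  have hcv : c • v ∈ Metric.ball (0 : E) 1 := by
    rw [mem_ball_zero_iff, norm_smul]
    calc ‖c‖ * ‖v‖ ≤ ‖c‖ * (1 + ‖v‖) := by gcongr; linarith
      _ < 1 := by rwa [← lt_div_iff₀ (by positivity), one_div]
  have h := hnorm _ hcv
  rw [eq_fderiv_of_norm_apply_eq hf hnorm hcv, map_smul, norm_smul, norm_smul] at h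
  exact mul_left_cancel₀ hc0.ne' h

end Cartan

section Automorphism

variable {n : ℕ}

theorem IsHolomorphicMap.comp {f g : Ball n → Ball n} (hf : IsHolomorphicMap f)
    (hg : IsHolomorphicMap g) : IsHolomorphicMap (f ∘ g) := by
  obtain ⟨F, hF, hFf⟩ := hf
  obtain ⟨G, hG, hGg⟩ := hg
  refine ⟨F ∘ G, hF.comp hG fun z hz => ?_, fun z => ?_⟩
  · rw [hGg ⟨z, hz⟩]
    exact (g ⟨z, hz⟩).2
  · simp only [Function.comp_apply, hGg, hFf]

theorem IsBallAut.trans {Φ Ψ : Ball n ≃ Ball n} (hΦ : IsBallAut Φ) (hΨ : IsBallAut Ψ) :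
    IsBallAut (Φ.trans Ψ) :=
  ⟨hΨ.1.comp hΦ.1, hΦ.2.comp hΨ.2⟩

theorem IsBallAut.symm {Φ : Ball n ≃ Ball n} (hΦ : IsBallAut Φ) : IsBallAut Φ.symm :=
  ⟨hΦ.2, hΦ.1⟩

theorem Ball.norm_lt (z : Ball n) : ‖z.1‖ < 1 :=
  mem_ball_zero_iff.1 z.2

/-- The centre of the ball. -/
def Ball.zero (n : ℕ) : Ball n := ⟨0, by simp⟩

/-- The Möbius map as a self-map of the ball. -/
def moebiusEquiv (a : Ball n) : Ball n ≃ Ball n where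
  toFun z := ⟨moebius a.1 z.1, mem_ball_zero_iff.2 (norm_moebius_lt_one a.norm_lt z.norm_lt)⟩
  invFun z := ⟨moebius a.1 z.1, mem_ball_zero_iff.2 (norm_moebius_lt_one a.norm_lt z.norm_lt)⟩
  left_inv z := Subtype.ext (moebius_moebius a.norm_lt z.norm_lt)
  right_inv z := Subtype.ext (moebius_moebius a.norm_lt z.norm_lt)

theorem isBallAut_moebiusEquiv (a : Ball n) : IsBallAut (moebiusEquiv a) :=
  ⟨⟨moebius a.1, differentiableOn_moebius a.norm_lt, fun _ => rfl⟩,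
    ⟨moebius a.1, differentiableOn_moebius a.norm_lt, fun _ => rfl⟩⟩

theorem moebiusEquiv_self (a : Ball n) : moebiusEquiv a a = Ball.zero n :=
  Subtype.ext (moebius_self a.norm_lt)

/-- The self-map of the ball induced by a unitary map. -/
def unitaryEquiv (U : EuclideanSpace ℂ (Fin n) ≃ₗᵢ[ℂ] EuclideanSpace ℂ (Fin n)) :
    Ball n ≃ Ball n where
  toFun z := ⟨U z.1, mem_ball_zero_iff.2 (by simpa using z.norm_lt)⟩
  invFun z := ⟨U.symm z.1, mem_ball_zero_iff.2 (by simpa using z.norm_lt)⟩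
  left_inv z := Subtype.ext (by simp)
  right_inv z := Subtype.ext (by simp)

theorem isBallAut_unitaryEquiv
    (U : EuclideanSpace ℂ (Fin n) ≃ₗᵢ[ℂ] EuclideanSpace ℂ (Fin n)) :
    IsBallAut (unitaryEquiv U) :=
  ⟨⟨U, U.toContinuousLinearEquiv.differentiable.differentiableOn, fun _ => rfl⟩,
    ⟨U.symm, U.symm.toContinuousLinearEquiv.differentiable.differentiableOn, fun _ => rfl⟩⟩

theorem unitaryEquiv_zero (U : EuclideanSpace ℂ (Fin n) ≃ₗᵢ[ℂ] EuclideanSpace ℂ (Fin n)) :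
    unitaryEquiv U (Ball.zero n) = Ball.zero n :=
  Subtype.ext (map_zero U)

theorem IsHolomorphicMap.norm_apply_le {f : Ball n → Ball n} (hf : IsHolomorphicMap f)
    (h0 : f (Ball.zero n) = Ball.zero n) (z : Ball n) : ‖(f z).1‖ ≤ ‖z.1‖ := by
  obtain ⟨F, hF, hFf⟩ := hf
  rw [← hFf]
  refine Complex.norm_le_norm_of_mapsTo_ball hF (fun w hw => ?_) ?_ z.norm_lt
  · rw [hFf ⟨w, hw⟩]
    exact Metric.ball_subset_closedBall (f ⟨w, hw⟩).2
  · exact (hFf (Ball.zero n)).trans (congrArg Subtype.val h0)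

theorem IsBallAut.norm_apply {Φ : Ball n ≃ Ball n} (hΦ : IsBallAut Φ)
    (h0 : Φ (Ball.zero n) = Ball.zero n) (z : Ball n) : ‖(Φ z).1‖ = ‖z.1‖ :=
  (hΦ.1.norm_apply_le h0 z).antisymm <| by
    simpa using hΦ.2.norm_apply_le (Φ.symm_apply_eq.2 h0.symm) (Φ z)

theorem IsBallAut.inner_apply {Φ : Ball n ≃ Ball n} (hΦ : IsBallAut Φ)
    (h0 : Φ (Ball.zero n) = Ball.zero n) (z w : Ball n) :
    inner ℂ (Φ z).1 (Φ w).1 = inner ℂ z.1 w.1 := by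
  obtain ⟨F, hF, hFΦ⟩ := hΦ.1
  obtain ⟨L, hL⟩ := exists_linearIsometry_eqOn_ball hF fun v hv => by
    rw [hFΦ ⟨v, hv⟩, hΦ.norm_apply h0]
  rw [← hFΦ, ← hFΦ, hL z.2, hL w.2, L.inner_map_map]

theorem IsBallAut.inner_apply_of_apply_eq_zero {Φ : Ball n ≃ Ball n} (hΦ : IsBallAut Φ)
    {a : Ball n} (ha : Φ a = Ball.zero n) (z w : Ball n) :
    inner ℂ (Φ z).1 (Φ w).1 = inner ℂ (moebius a.1 z.1) (moebius a.1 w.1) := by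
  have h0 : (moebiusEquiv a).symm (Ball.zero n) = a := by
    rw [← moebiusEquiv_self a, Equiv.symm_apply_apply]
  have h := ((isBallAut_moebiusEquiv a).symm.trans hΦ).inner_apply
    (by rw [Equiv.trans_apply, h0, ha]) (moebiusEquiv a z) (moebiusEquiv a w)
  rwa [Equiv.trans_apply, Equiv.trans_apply, Equiv.symm_apply_apply, Equiv.symm_apply_apply] at h

theorem IsBallAut.norm_apply_of_apply_eq_zero {Φ : Ball n ≃ Ball n} (hΦ : IsBallAut Φ)
    {a : Ball n} (ha : Φ a = Ball.zero n) (z : Ball n) :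
    ‖(Φ z).1‖ = ‖moebius a.1 z.1‖ := by
  simp only [@norm_eq_sqrt_re_inner ℂ, hΦ.inner_apply_of_apply_eq_zero ha]

theorem IsBallAut.moebiusCollinear_iff {Φ : Ball n ≃ Ball n} (hΦ : IsBallAut Φ)
    (a z w : Ball n) :
    MoebiusCollinear (Φ a).1 (Φ z).1 (Φ w).1 ↔ MoebiusCollinear a.1 z.1 w.1 := by
  have hΨ := hΦ.trans (isBallAut_moebiusEquiv (Φ a))
  have ha : (Φ.trans (moebiusEquiv (Φ a))) a = Ball.zero n := moebiusEquiv_self (Φ a)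
  rw [MoebiusCollinear, MoebiusCollinear, ← hΨ.inner_apply_of_apply_eq_zero ha,
    ← hΨ.norm_apply_of_apply_eq_zero ha, ← hΨ.norm_apply_of_apply_eq_zero ha]
  rfl

end Automorphism

section Coordinates

variable {n m : ℕ}

theorem coord_val (z : Ball n) (i : Fin n) : coord z i = z.1 i := by
  simp [coord]

theorem coord_of_le (z : Ball n) {i : ℕ} (hi : n ≤ i) : coord z i = 0 := by
  simp [coord, hi]

theorem coord_zero (i : ℕ) : coord (Ball.zero n) i = 0 := by
  simp [coord, Ball.zero]

theorem Ball.ext_coord {z w : Ball n} (h : ∀ i, coord z i = coord w i) : z = w :=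
  Subtype.ext (PiLp.ext fun i => by rw [← coord_val, ← coord_val, h])

theorem inner_eq_sum_coord (z w : Ball n) {N : ℕ} (hN : n ≤ N) :
    inner ℂ z.1 w.1 = ∑ i ∈ Finset.range N, coord w i * starRingEnd ℂ (coord z i) := by
  have hsub : ∑ i ∈ Finset.range n, coord w i * starRingEnd ℂ (coord z i) =
      ∑ i ∈ Finset.range N, coord w i * starRingEnd ℂ (coord z i) :=
    Finset.sum_subset (Finset.range_mono hN) fun i _ hi => by
      rw [coord_of_le w (by simpa using hi), zero_mul]
  rw [← hsub, ← Fin.sum_univ_eq_sum_range (fun i => coord w i * starRingEnd ℂ (coord z i)),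
    PiLp.inner_apply]
  simp [coord_val]

theorem inner_eq_of_coord_eq {z z' : Ball n} {w w' : Ball m}
    (h : ∀ i, coord z i = coord w i) (h' : ∀ i, coord z' i = coord w' i) :
    inner ℂ z.1 z'.1 = inner ℂ w.1 w'.1 := by
  simp only [inner_eq_sum_coord z z' (le_max_left n m), inner_eq_sum_coord w w' (le_max_right n m),
    h, h']

theorem exists_ball_two (z : Ball n) (hz : ∀ i, 2 ≤ i → coord z i = 0) :
    ∃ x : Ball 2, x.1 = !₂[coord z 0, coord z 1] ∧ ∀ i, coord z i = coord x i := by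
  have hnorm : ‖(!₂[coord z 0, coord z 1] : EuclideanSpace ℂ (Fin 2))‖ = ‖z.1‖ := by
    have hz' := inner_eq_sum_coord z z (Nat.le_add_right n 2)
    rw [← Finset.sum_subset (Finset.range_mono (Nat.le_add_left 2 n)) fun i _ hi => by
      rw [hz i (not_lt.1 (by simpa using hi)), zero_mul]] at hz'
    rw [@norm_eq_sqrt_re_inner ℂ, @norm_eq_sqrt_re_inner ℂ _ _ _ _ z.1, hz', PiLp.inner_apply,
      Fin.sum_univ_two, Finset.sum_range_succ, Finset.sum_range_one]
    rfl
  refine ⟨⟨_, mem_ball_zero_iff.2 (hnorm.trans_lt z.norm_lt)⟩, rfl, fun i => ?_⟩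
  match i with
  | 0 => simp [coord]
  | 1 => simp [coord]
  | k + 2 => rw [hz _ (Nat.le_add_left 2 k), coord_of_le _ (Nat.le_add_left 2 k)]

end Coordinates

section NormalForm

variable {n : ℕ}

theorem exists_orthonormalBasis_triangular (u v : EuclideanSpace ℂ (Fin n)) :
    ∃ b : OrthonormalBasis (Fin n) ℂ (EuclideanSpace ℂ (Fin n)),
      (∀ i : Fin n, 1 ≤ (i : ℕ) → b.repr u i = 0) ∧
      ∀ i : Fin n, 2 ≤ (i : ℕ) → b.repr v i = 0 := by
  let f : Fin n → EuclideanSpace ℂ (Fin n) := fun i =>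
    if (i : ℕ) = 0 then u else if (i : ℕ) = 1 then v else 0
  have htri := fun i j (h : i < j) =>
    InnerProductSpace.gramSchmidtOrthonormalBasis_inv_triangular' (𝕜 := ℂ) (h := by simp) f h
  refine ⟨InnerProductSpace.gramSchmidtOrthonormalBasis (𝕜 := ℂ) (h := by simp) f,
    fun i hi => ?_, fun i hi => ?_⟩
  · simpa [f] using htri ⟨0, by omega⟩ i (Fin.lt_def.2 hi)
  · simpa [f] using htri ⟨1, by omega⟩ i (Fin.lt_def.2 hi)

/-- Multiplication by a complex number of modulus one as a linear isometry. -/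
def phaseEquiv (c : ℂ) (hc : ‖c‖ = 1) : ℂ ≃ₗᵢ[ℂ] ℂ where
  toLinearEquiv := LinearEquiv.smulOfUnit (Units.mk0 c (norm_ne_zero_iff.1 (by simp [hc])))
  norm_map' z := by
    change ‖c * z‖ = ‖z‖
    rw [norm_mul, hc, one_mul]

theorem exists_unitary_triangular (u v : EuclideanSpace ℂ (Fin n)) :
    ∃ U : EuclideanSpace ℂ (Fin n) ≃ₗᵢ[ℂ] EuclideanSpace ℂ (Fin n),
      (∀ i : Fin n, (i : ℕ) = 0 → 0 ≤ U u i) ∧ (∀ i : Fin n, (i : ℕ) = 1 → 0 ≤ U v i) ∧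
      (∀ i : Fin n, 1 ≤ (i : ℕ) → U u i = 0) ∧ ∀ i : Fin n, 2 ≤ (i : ℕ) → U v i = 0 := by
  obtain ⟨b, hu, hv⟩ := exists_orthonormalBasis_triangular u v
  choose c hc hnorm using fun i : Fin n =>
    Complex.exists_norm_eq_mul_self (if (i : ℕ) = 0 then b.repr u i else b.repr v i)
  let U := b.repr.trans (LinearIsometryEquiv.piLpCongrRight 2 fun i => phaseEquiv (c i) (hc i))
  have hU : ∀ w i, U w i = c i * b.repr w i := fun _ _ => rfl
  refine ⟨U, fun i hi => ?_, fun i hi => ?_, fun i hi => ?_, fun i hi => ?_⟩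
  · have hUu := hnorm i
    rw [if_pos hi, ← hU] at hUu
    exact hUu ▸ Complex.zero_le_real.2 (norm_nonneg _)
  · have hUv := hnorm i
    rw [if_neg (by omega), ← hU] at hUv
    exact hUv ▸ Complex.zero_le_real.2 (norm_nonneg _)
  · rw [hU, hu i hi, mul_zero]
  · rw [hU, hv i hi, mul_zero]

theorem exists_isBallAut_triangular (y : Fin 3 → Ball n) :
    ∃ Φ : Ball n ≃ Ball n, IsBallAut Φ ∧ Φ (y 0) = Ball.zero n ∧
      0 ≤ coord (Φ (y 1)) 0 ∧ 0 ≤ coord (Φ (y 2)) 1 ∧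
      (∀ i, 1 ≤ i → coord (Φ (y 1)) i = 0) ∧ ∀ i, 2 ≤ i → coord (Φ (y 2)) i = 0 := by
  obtain ⟨U, hu0, hv1, hu, hv⟩ :=
    exists_unitary_triangular (moebius (y 0).1 (y 1).1) (moebius (y 0).1 (y 2).1)
  refine ⟨(moebiusEquiv (y 0)).trans (unitaryEquiv U),
    (isBallAut_moebiusEquiv _).trans (isBallAut_unitaryEquiv U), ?_, ?_, ?_, fun i hi => ?_,
    fun i hi => ?_⟩
  · rw [Equiv.trans_apply, moebiusEquiv_self, unitaryEquiv_zero]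
  all_goals
    rw [coord]
    split_ifs with h
    · first
        | exact hu0 ⟨_, h⟩ rfl
        | exact hv1 ⟨_, h⟩ rfl
        | exact hu ⟨i, h⟩ hi
        | exact hv ⟨i, h⟩ hi
    · rfl

theorem exists_isNormalFormOf (y : Fin 3 → Ball n) (hy : Function.Injective y) :
    ∃ x, IsNormalFormOf x y := by
  obtain ⟨Φ, hΦ, h0, h1nonneg, h2nonneg, h1, h2⟩ := exists_isBallAut_triangular y
  have h0' : ∀ i, coord (Φ (y 0)) i = 0 := fun i => by rw [h0, coord_zero]
  obtain ⟨s, hs, hs1⟩ := RCLike.nonneg_iff_exists_ofReal.1 h1nonneg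
  obtain ⟨t, ht, ht2⟩ := RCLike.nonneg_iff_exists_ofReal.1 h2nonneg
  have hs0 : s ≠ 0 := by
    rintro rfl
    refine absurd (hy (Φ.injective (Ball.ext_coord fun i => ?_))) (zero_ne_one (α := Fin 3))
    rw [h0']
    rcases Nat.eq_zero_or_pos i with rfl | hi
    · simpa using hs1
    · exact (h1 i hi).symm
  have hball : ∀ j : Fin 3, ∃ x : Ball 2, x.1 = !₂[coord (Φ (y j)) 0, coord (Φ (y j)) 1] ∧
      ∀ i, coord (Φ (y j)) i = coord x i := fun j => by
    refine exists_ball_two _ fun i hi => ?_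
    fin_cases j
    exacts [h0' i, h1 i (by omega), h2 i hi]
  choose x hx hΦx using hball
  refine ⟨x, ⟨s, t, coord (Φ (y 2)) 0, hs.lt_of_ne' hs0, ht, ?_, ?_, ?_⟩, Φ, hΦ, hΦx⟩
  · rw [hx, h0', h0']
  · rw [hx, h1 1 le_rfl, ← hs1]
    rfl
  · rw [hx, ← ht2]
    rfl

section HasNormalCoords

variable {x : Fin 3 → Ball 2} {s t : ℝ} {w : ℂ}

theorem HasNormalCoords.inner_one_one (h : HasNormalCoords x s t w) :
    inner ℂ (x 1).1 (x 1).1 = (s : ℂ) ^ 2 := by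
  rw [h.2.1, PiLp.inner_apply, Fin.sum_univ_two]
  simp [sq, ← Complex.ofReal_mul]

theorem HasNormalCoords.inner_one_two (h : HasNormalCoords x s t w) :
    inner ℂ (x 1).1 (x 2).1 = s * w := by
  simp [h.2.1, h.2.2, PiLp.inner_apply, mul_comm]

theorem HasNormalCoords.inner_two_two (h : HasNormalCoords x s t w) :
    inner ℂ (x 2).1 (x 2).1 = ((‖w‖ ^ 2 + t ^ 2 : ℝ) : ℂ) := by
  rw [h.2.2, PiLp.inner_apply, Fin.sum_univ_two]
  simp [sq, ← Complex.ofReal_mul]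

theorem HasNormalCoords.moebiusCollinear_iff (h : HasNormalCoords x s t w) (hs : 0 < s) :
    MoebiusCollinear (x 0).1 (x 1).1 (x 2).1 ↔ t = 0 := by
  have h0 : (x 0).1 = 0 := by
    rw [h.1]
    ext i
    fin_cases i <;> rfl
  have h1 : ‖(x 1).1‖ ^ 2 = s ^ 2 := by
    exact_mod_cast (inner_self_eq_ofReal _).symm.trans h.inner_one_one
  have h2 : ‖(x 2).1‖ ^ 2 = ‖w‖ ^ 2 + t ^ 2 := by
    exact_mod_cast (inner_self_eq_ofReal _).symm.trans h.inner_two_two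
  rw [h0, moebiusCollinear_zero_iff, h.inner_one_two,
    ← pow_left_inj₀ (norm_nonneg _) (by positivity) two_ne_zero, mul_pow, h1, h2, norm_mul, mul_pow,
    Complex.norm_real, Real.norm_eq_abs, sq_abs, mul_right_inj' (by positivity), left_eq_add,
    pow_eq_zero_iff two_ne_zero]

end HasNormalCoords

variable {x x' : Fin 3 → Ball 2} {y : Fin 3 → Ball n}

theorem ClassN.eq_of_inner_eq (hx : ClassN x) (hx' : ClassN x')
    (hi : ∀ i j, inner ℂ (x i).1 (x j).1 = inner ℂ (x' i).1 (x' j).1) : x = x' := by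
  obtain ⟨s, t, w, hs, ht, h⟩ := hx
  obtain ⟨s', t', w', hs', ht', h'⟩ := hx'
  obtain rfl : s = s' := by
    have h11 := hi 1 1
    rw [h.inner_one_one, h'.inner_one_one] at h11
    exact (pow_left_inj₀ hs.le hs'.le two_ne_zero).1 (by exact_mod_cast h11)
  obtain rfl : w = w' := by
    have h12 := hi 1 2
    rw [h.inner_one_two, h'.inner_one_two] at h12
    exact mul_left_cancel₀ (by exact_mod_cast hs.ne') h12
  obtain rfl : t = t' := by
    have h22 := hi 2 2
    rw [h.inner_two_two, h'.inner_two_two, Complex.ofReal_inj, add_right_inj] at h22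
    exact (pow_left_inj₀ ht ht' two_ne_zero).1 h22
  funext j
  refine Subtype.ext ?_
  fin_cases j
  exacts [h.1.trans h'.1.symm, h.2.1.trans h'.2.1.symm, h.2.2.trans h'.2.2.symm]

theorem ClassN.classE_iff (hx : ClassN x) :
    ClassE x ↔ MoebiusCollinear (x 0).1 (x 1).1 (x 2).1 := by
  constructor
  · rintro ⟨s, w, hs, h⟩
    exact (h.moebiusCollinear_iff hs).2 rfl
  · obtain ⟨s, t, w, hs, -, h⟩ := hx
    intro hcol
    obtain rfl := (h.moebiusCollinear_iff hs).1 hcol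
    exact ⟨s, w, hs, h⟩

theorem ClassN.coord_zero (hx : ClassN x) (i : ℕ) : coord (x 0) i = 0 := by
  obtain ⟨s, t, w, -, -, h⟩ := hx
  rw [coord, h.1]
  split_ifs with hi
  · interval_cases i <;> rfl
  · rfl

theorem IsNormalFormOf.injective (h : IsNormalFormOf x y) (hy : Function.Injective y) :
    Function.Injective x := by
  obtain ⟨-, Φ, -, hΦx⟩ := h
  exact fun i j hij => hy (Φ.injective (Ball.ext_coord fun k => by rw [hΦx, hΦx, hij]))

theorem IsNormalFormOf.inner_eq (h : IsNormalFormOf x y) (i j : Fin 3) :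
    inner ℂ (x i).1 (x j).1 =
      inner ℂ (moebius (y 0).1 (y i).1) (moebius (y 0).1 (y j).1) := by
  obtain ⟨hx, Φ, hΦ, hΦx⟩ := h
  have h0 : Φ (y 0) = Ball.zero n := Ball.ext_coord fun i => by
    rw [hΦx, hx.coord_zero, DruryArveson.coord_zero]
  rw [← inner_eq_of_coord_eq (hΦx i) (hΦx j), hΦ.inner_apply_of_apply_eq_zero h0]

theorem existsUnique_isNormalFormOf (y : Fin 3 → Ball n) (hy : Function.Injective y) :
    ∃! x, IsNormalFormOf x y :=
  (exists_isNormalFormOf y hy).elim fun x hx =>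
    ⟨x, hx, fun _ hx' => hx'.1.eq_of_inner_eq hx.1 fun i j => by rw [hx'.inner_eq, hx.inner_eq]⟩

theorem IsNormalFormOf.classE_iff (h : IsNormalFormOf x y) :
    ClassE x ↔ MoebiusCollinear (y 0).1 (y 1).1 (y 2).1 := by
  have h0 : (x 0).1 = 0 := congrArg Subtype.val <|
    Ball.ext_coord (w := Ball.zero 2) fun i => by rw [h.1.coord_zero, coord_zero]
  have hnorm : ∀ j, ‖(x j).1‖ = ‖moebius (y 0).1 (y j).1‖ := fun j => by
    simp only [@norm_eq_sqrt_re_inner ℂ, h.inner_eq]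
  rw [h.1.classE_iff, h0, moebiusCollinear_zero_iff, h.inner_eq, hnorm, hnorm, MoebiusCollinear]

end NormalForm

section Geodesic

variable {n : ℕ}

theorem norm_inner_of_forall_eq_zero {z w : EuclideanSpace ℂ (Fin n)}
    (hz : ∀ i : Fin n, (i : ℕ) ≠ 0 → z i = 0) (hw : ∀ i : Fin n, (i : ℕ) ≠ 0 → w i = 0) :
    ‖inner ℂ z w‖ = ‖z‖ * ‖w‖ := by
  rcases n with - | n
  · simp [Subsingleton.elim z 0]
  · have hsingle : ∀ v : EuclideanSpace ℂ (Fin (n + 1)),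
        (∀ i : Fin (n + 1), (i : ℕ) ≠ 0 → v i = 0) → v = EuclideanSpace.single 0 (v 0) := by
      intro v hv
      ext i
      rcases eq_or_ne i 0 with rfl | hi
      · simp
      · rw [hv i (mt Fin.val_eq_zero_iff.1 hi), PiLp.single_apply, if_neg hi]
    rw [hsingle z hz, hsingle w hw]
    simp [EuclideanSpace.inner_single_left]

theorem IsComplexGeodesic.moebiusCollinear {G : Set (Ball n)} (hG : IsComplexGeodesic G)
    {a z w : Ball n} (ha : a ∈ G) (hz : z ∈ G) (hw : w ∈ G) : MoebiusCollinear a.1 z.1 w.1 := by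
  obtain ⟨Φ, hΦ, rfl⟩ := hG
  obtain ⟨a, ha, rfl⟩ := ha
  obtain ⟨z, hz, rfl⟩ := hz
  obtain ⟨w, hw, rfl⟩ := hw
  rw [hΦ.moebiusCollinear_iff]
  refine norm_inner_of_forall_eq_zero (fun i hi => ?_) fun i hi => ?_
  · simp [moebius, ha i hi, hz i hi]
  · simp [moebius, ha i hi, hw i hi]

theorem IsNormalFormOf.exists_isComplexGeodesic {x : Fin 3 → Ball 2} {y : Fin 3 → Ball n}
    (h : IsNormalFormOf x y) (hE : ClassE x) :
    ∃ G : Set (Ball n), IsComplexGeodesic G ∧ ∀ j, y j ∈ G := by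
  obtain ⟨-, Φ, hΦ, hΦx⟩ := h
  obtain ⟨s, w, -, h0, h1, h2⟩ := hE
  refine ⟨_, ⟨Φ.symm, hΦ.symm, rfl⟩, fun j => ⟨Φ (y j), fun i hi => ?_, Φ.symm_apply_apply _⟩⟩
  rw [← coord_val, hΦx, coord]
  split_ifs with hi2
  · have hi1 : (i : ℕ) = 1 := by omega
    simp only [hi1]
    fin_cases j
    · simp [h0]
    · simp [h1]
    · simp [h2]
  · rfl

theorem IsNormalFormOf.exists_isComplexGeodesic_iff {x : Fin 3 → Ball 2} {y : Fin 3 → Ball n}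
    (h : IsNormalFormOf x y) :
    (∃ G : Set (Ball n), IsComplexGeodesic G ∧ ∀ j, y j ∈ G) ↔ ClassE x :=
  ⟨fun ⟨_, hG, hy⟩ => h.classE_iff.2 (hG.moebiusCollinear (hy 0) (hy 1) (hy 2)),
    h.exists_isComplexGeodesic⟩

end Geodesic

section Kernel

variable {n : ℕ}

theorem inner_kerVec (z : Ball n) (f : DA n) : inner ℂ (kerVec z) f = f z := by
  rw [kerVec, RKHS.kerFun_inner]
  simp

theorem kerVec_apply_ne_zero (w z : Ball n) : kerVec w z ≠ 0 := by
  rw [kerVec_apply]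
  exact inv_ne_zero (one_sub_inner_ne_zero w.norm_lt z.norm_lt)

theorem conj_kerVec_apply (w z : Ball n) : starRingEnd ℂ (kerVec w z) = kerVec z w := by
  rw [← inner_kerVec, inner_conj_symm, inner_kerVec]

theorem kerVec_apply_self (z : Ball n) : kerVec z z = ((‖(kerVec z : DA n)‖ ^ 2 : ℝ) : ℂ) := by
  rw [← inner_kerVec, inner_self_eq_ofReal]

theorem norm_kerVec_pos (z : Ball n) : 0 < ‖(kerVec z : DA n)‖ :=
  norm_pos_iff.2 fun h => kerVec_apply_ne_zero z z (by rw [← inner_kerVec, h, inner_zero_left])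

/-- The component of `k_q` orthogonal to `k_p`. -/
def rejection (p q : Ball n) : DA n := kerVec q - (kerVec q p / kerVec p p) • kerVec p

theorem inner_moebius_moebius (p w z : Ball n) :
    inner ℂ (moebius p.1 w.1) (moebius p.1 z.1) =
      1 - kerVec w p * kerVec p z / (kerVec p p * kerVec w z) := by
  have h := one_sub_inner_moebius p.norm_lt z.norm_lt w.norm_lt
  rw [sub_eq_iff_eq_add, add_comm, ← sub_eq_iff_eq_add] at h
  rw [← h]
  simp only [kerVec_apply]
  rw [← mul_inv, ← mul_inv, div_eq_mul_inv, div_eq_mul_inv, inv_inv, mul_comm (_ * _)⁻¹]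

-- The complete Pick property: the normalized remainder of the kernel is again a Gram matrix.
theorem rejection_apply (p q z : Ball n) :
    rejection p q z = kerVec q z * inner ℂ (moebius p.1 q.1) (moebius p.1 z.1) := by
  have hp := kerVec_apply_ne_zero p p
  have hq := kerVec_apply_ne_zero q z
  rw [inner_moebius_moebius, rejection, RKHS.coe_sub]
  simp only [RKHS.coe_smul, Pi.sub_apply, Pi.smul_apply, smul_eq_mul]
  field_simp

theorem norm_rejection (p q : Ball n) :
    ‖rejection p q‖ = ‖(kerVec q : DA n)‖ * ‖moebius p.1 q.1‖ := by
  rw [← sq_eq_sq₀ (norm_nonneg _) (by positivity), mul_pow]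
  have horth : inner ℂ (kerVec p) (rejection p q) = 0 := by
    rw [inner_kerVec, rejection_apply, moebius_self p.norm_lt, inner_zero_right, mul_zero]
  have h : inner ℂ (rejection p q) (rejection p q) = rejection p q q := by
    rw [← inner_kerVec]
    conv_lhs =>
      rw [rejection, inner_sub_left, inner_smul_left, ← rejection, horth, mul_zero, sub_zero]
  rw [rejection_apply, kerVec_apply_self, inner_self_eq_ofReal, inner_self_eq_ofReal] at h
  exact_mod_cast h

end Kernel

section Invariants

variable {ι : Type*} {n : ℕ} (x : ι → Ball n)

theorem gram_eq_kerVec_apply (i j : ι) : gram x i j = kerVec (x i) (x j) :=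
  inner_kerVec _ _

theorem delta_eq_norm_moebius (i j : ι) : delta x i j = ‖moebius (x i).1 (x j).1‖ := by
  have h := inner_moebius_moebius (x i) (x j) (x j)
  rw [← conj_kerVec_apply (x i), ← Complex.normSq_eq_conj_mul_self, Complex.normSq_eq_norm_sq,
    kerVec_apply_self, kerVec_apply_self, inner_self_eq_ofReal] at h
  have hsq : 1 - ‖gram x i j‖ ^ 2 / ((gram x i i).re * (gram x j j).re) =
      ‖moebius (x i).1 (x j).1‖ ^ 2 := by
    simp only [gram_eq_kerVec_apply, kerVec_apply_self, Complex.ofReal_re]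
    exact_mod_cast h.symm
  rw [delta, hsq, Real.sqrt_sq (norm_nonneg _)]

theorem delta_comm (i j : ι) : delta x i j = delta x j i := by
  have h : ‖gram x i j‖ = ‖gram x j i‖ := by
    rw [gram_eq_kerVec_apply, gram_eq_kerVec_apply, ← conj_kerVec_apply, RCLike.norm_conj]
  rw [delta, delta, h, mul_comm (gram x i i).re]

variable {x}

theorem norm_moebius_pos (hx : Function.Injective x) {i j : ι} (hij : i ≠ j) :
    0 < ‖moebius (x i).1 (x j).1‖ :=
  norm_pos_iff.2 <| moebius_ne_zero (x i).norm_lt (x j).norm_lt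
    fun h => hij (hx (Subtype.ext h)).symm

theorem LFsq_eq_delta_sq_iff (hx : Function.Injective x) {i j l : ι} (hij : i ≠ j) :
    LFsq x i j l = delta x i l ^ 2 ↔ MoebiusCollinear (x i).1 (x j).1 (x l).1 := by
  have hpos := norm_moebius_pos hx hij
  rw [LFsq, gram_eq_kerVec_apply, gram_eq_kerVec_apply, gram_eq_kerVec_apply, gram_eq_kerVec_apply,
    mul_comm (kerVec (x j) (x l)), ← inner_moebius_moebius, delta_eq_norm_moebius,
    delta_eq_norm_moebius, one_div, inv_mul_eq_iff_eq_mul₀ (by positivity), ← mul_pow,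
    pow_left_inj₀ (norm_nonneg _) (by positivity) two_ne_zero, MoebiusCollinear]

end Invariants

section KernelSpan

variable {ι : Type*} {n : ℕ} {x : ι → Ball n}

variable (x) in
/-- The kernel function `k_{x_i}` as an element of `DA_n(X)`. -/
def kerSub (i : ι) : DASub x := ⟨kerVec (x i), Submodule.subset_span ⟨i, rfl⟩⟩

-- Restates `inner_smul_left` for the scalar action that instance search finds on `DASub x`, which
-- agrees with the one of its inner product structure only after unfolding `DA n`.
theorem DASub.inner_smul_left (c : ℂ) (u v : DASub x) :
    inner ℂ (c • u) v = starRingEnd ℂ c * inner ℂ u v := by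
  change inner ℂ ((c • u : DASub x) : DA n) (v : DA n) = _
  rw [Submodule.coe_smul, _root_.inner_smul_left]
  rfl

theorem inner_kerSub (i : ι) (h : DASub x) : inner ℂ (kerSub x i) h = (h : DA n) (x i) :=
  inner_kerVec (x i) h

theorem norm_kerSub_pos (i : ι) : 0 < ‖kerSub x i‖ :=
  norm_kerVec_pos (x i)

theorem span_range_kerSub : Submodule.span ℂ (Set.range (kerSub x)) = ⊤ := by
  have h : Set.range (kerSub x) = ((↑) : DASub x → DA n) ⁻¹' Set.range fun i => kerVec (x i) := by
    ext v
    simp [kerSub, Subtype.ext_iff]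
  rw [h]
  exact Submodule.span_span_coe_preimage

instance [Finite ι] : FiniteDimensional ℂ (DASub x) :=
  FiniteDimensional.span_of_finite ℂ (Set.finite_range _)

theorem DASub.ext_apply {f g : DASub x} (h : ∀ i, (f : DA n) (x i) = (g : DA n) (x i)) :
    f = g := by
  refine ext_inner_left ℂ fun v => ?_
  have hv : v ∈ Submodule.span ℂ (Set.range (kerSub x)) := span_range_kerSub ▸ Submodule.mem_top
  induction hv using Submodule.span_induction with
  | mem v hv =>
    obtain ⟨i, rfl⟩ := hv
    rw [inner_kerSub, inner_kerSub, h]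
  | zero => rw [inner_zero_left, inner_zero_left]
  | add v w _ _ hv hw => rw [inner_add_left, inner_add_left, hv, hw]
  | smul c v _ hv => rw [inner_smul_left, inner_smul_left, hv]

theorem Multiplier.ext_symbol {m m' : Multiplier x} (h : ∀ i, m.symbol i = m'.symbol i) :
    m = m' := by
  refine Multiplier.ext (funext h) (ContinuousLinearMap.ext fun v => DASub.ext_apply fun i => ?_)
  rw [m.op_apply, m'.op_apply, h]

theorem Multiplier.norm_def (m : Multiplier x) : ‖m‖ = ‖m.op‖ := rfl

theorem Multiplier.symbol_mul (m m' : Multiplier x) (i : ι) :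
    (m * m').symbol i = m.symbol i * m'.symbol i := rfl

theorem Multiplier.symbol_smul (c : ℂ) (m : Multiplier x) (i : ι) :
    (c • m).symbol i = c * m.symbol i := rfl

variable [Finite ι]

theorem Multiplier.adjoint_op_kerSub (m : Multiplier x) (i : ι) :
    ContinuousLinearMap.adjoint m.op (kerSub x i) =
      starRingEnd ℂ (m.symbol i) • kerSub x i := by
  refine ext_inner_right ℂ fun v => ?_
  rw [ContinuousLinearMap.adjoint_inner_left, inner_kerSub, m.op_apply,
    DASub.inner_smul_left, inner_kerSub, Complex.conj_conj]

end KernelSpan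

section Pick

theorem exists_contraction_of_norm_sum_le {𝕜 H K ι : Type*} [RCLike 𝕜] [NormedAddCommGroup H]
    [NormedSpace 𝕜 H] [NormedAddCommGroup K] [NormedSpace 𝕜 K] [Fintype ι] {v : ι → H} {w : ι → K}
    (hv : Submodule.span 𝕜 (Set.range v) = ⊤)
    (hle : ∀ c : ι → 𝕜, ‖∑ i, c i • w i‖ ≤ ‖∑ i, c i • v i‖) :
    ∃ T : H →L[𝕜] K, ‖T‖ ≤ 1 ∧ ∀ i, T (v i) = w i := by
  classical
  obtain ⟨S, hS⟩ := (Fintype.linearCombination 𝕜 v).exists_rightInverse_of_surjective (by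
    rw [Fintype.range_linearCombination, hv])
  have hvS (u : H) : Fintype.linearCombination 𝕜 v (S u) = u := LinearMap.congr_fun hS u
  refine ⟨(Fintype.linearCombination 𝕜 w ∘ₗ S).mkContinuous 1 fun u => ?_,
    LinearMap.mkContinuous_norm_le _ zero_le_one _, fun i => ?_⟩
  · have h := hle (S u)
    rwa [← Fintype.linearCombination_apply 𝕜 v, hvS, ← one_mul ‖u‖] at h
  · have hi := hle (S (v i) - Pi.single i 1)
    rwa [← Fintype.linearCombination_apply 𝕜 v, ← Fintype.linearCombination_apply 𝕜 w, map_sub,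
      map_sub, hvS, Fintype.linearCombination_apply_single, Fintype.linearCombination_apply_single,
      one_smul, one_smul, sub_self, norm_zero, norm_le_zero_iff, sub_eq_zero] at hi

theorem norm_sum_smul_le_of_posSemidef_gram_sub {H K ι : Type*} [NormedAddCommGroup H]
    [InnerProductSpace ℂ H] [NormedAddCommGroup K] [InnerProductSpace ℂ K] [Fintype ι]
    {v : ι → H} {w : ι → K} (h : (Matrix.gram ℂ v - Matrix.gram ℂ w).PosSemidef) (c : ι → ℂ) :
    ‖∑ i, c i • w i‖ ≤ ‖∑ i, c i • v i‖ := by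
  have hc := (Complex.nonneg_iff.1 (h.dotProduct_mulVec_nonneg c)).1
  rw [Matrix.sub_mulVec, dotProduct_sub, Matrix.star_dotProduct_gram_mulVec,
    Matrix.star_dotProduct_gram_mulVec, inner_self_eq_ofReal, inner_self_eq_ofReal,
    ← Complex.ofReal_sub, Complex.ofReal_re, sub_nonneg] at hc
  exact le_of_sq_le_sq hc (norm_nonneg _)

theorem posSemidef_gram_sub_gram_of_norm_le_one {E F ι : Type*} [Finite ι]
    [NormedAddCommGroup E] [InnerProductSpace ℂ E] [NormedAddCommGroup F] [InnerProductSpace ℂ F]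
    (v : ι → E) {f : E →L[ℂ] F} (hf : ‖f‖ ≤ 1) :
    (Matrix.gram ℂ v - Matrix.gram ℂ (f ∘ v)).PosSemidef := by
  have h := ((Matrix.posSemidef_gram ℂ v).smul
    (sub_nonneg.2 (pow_le_one₀ (n := 2) (norm_nonneg f) hf))).add
    (Matrix.posSemidef_opNorm_smul_gram_sub_gram v f)
  rwa [sub_smul, one_smul, sub_add_sub_cancel] at h

variable {ι : Type*} {n : ℕ} {x : ι → Ball n} [Finite ι]

theorem exists_multiplier_of_posSemidef {f : ι → ℂ}
    (hf : (Matrix.of fun i j => (1 - f i * starRingEnd ℂ (f j)) * kerVec (x j) (x i)).PosSemidef) :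
    ∃ m : Multiplier x, ‖m‖ ≤ 1 ∧ ∀ i, m.symbol i = f i := by
  have hgram : (Matrix.gram ℂ (kerSub x) -
      Matrix.gram ℂ fun i => starRingEnd ℂ (f i) • kerSub x i).PosSemidef := by
    convert hf using 1
    ext i j
    rw [Matrix.sub_apply, Matrix.gram_apply, Matrix.gram_apply, DASub.inner_smul_left, inner_kerSub,
      inner_kerSub, Complex.conj_conj, Matrix.of_apply, Submodule.coe_smul, RKHS.coe_smul,
      Pi.smul_apply, smul_eq_mul, kerSub]
    ring
  cases nonempty_fintype ι
  obtain ⟨T, hT, hTk⟩ := exists_contraction_of_norm_sum_le span_range_kerSub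
    (norm_sum_smul_le_of_posSemidef_gram_sub hgram)
  refine ⟨⟨f, ContinuousLinearMap.adjoint T, fun h i => ?_⟩, ?_, fun _ => rfl⟩
  · rw [← inner_kerSub, ContinuousLinearMap.adjoint_inner_right, hTk, DASub.inner_smul_left,
      Complex.conj_conj, inner_kerSub]
  · rwa [Multiplier.norm_def, LinearIsometryEquiv.norm_map]

theorem posSemidef_one_sub_inner_moebius_mul_kerVec (p : Ball n) :
    (Matrix.of fun i j => (1 - inner ℂ (moebius p.1 (x j).1) (moebius p.1 (x i).1)) *
      kerVec (x j) (x i)).PosSemidef := by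
  convert Matrix.posSemidef_vecMulVec_self_star
    fun i => kerVec p (x i) / (‖(kerVec p : DA n)‖ : ℂ) using 1
  ext i j
  have hp := kerVec_apply_ne_zero p p
  have hji := kerVec_apply_ne_zero (x j) (x i)
  have hn : (‖(kerVec p : DA n)‖ : ℂ) ^ 2 = kerVec p p := by
    rw [kerVec_apply_self, Complex.ofReal_pow]
  rw [Matrix.of_apply, inner_moebius_moebius, sub_sub_cancel, Matrix.vecMulVec_apply, Pi.star_apply,
    RCLike.star_def, map_div₀, conj_kerVec_apply, Complex.conj_ofReal, div_mul_div_comm, ← sq, hn]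
  field_simp

theorem exists_multiplier_inner_moebius (p : Ball n) {u : EuclideanSpace ℂ (Fin n)}
    (hu : ‖u‖ ≤ 1) :
    ∃ m : Multiplier x, ‖m‖ ≤ 1 ∧ ∀ i, m.symbol i = inner ℂ u (moebius p.1 (x i).1) := by
  set e : ι → EuclideanSpace ℂ (Fin n) := fun i => moebius p.1 (x i).1
  have hk : (Matrix.of fun i j => kerVec (x j) (x i) : Matrix ι ι ℂ).PosSemidef := by
    have h : Matrix.gram ℂ (kerSub x) = Matrix.of fun i j => kerVec (x j) (x i) :=
      Matrix.ext fun i j => inner_kerSub i (kerSub x j)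
    exact h ▸ Matrix.posSemidef_gram ℂ (kerSub x)
  have hdiff := (posSemidef_gram_sub_gram_of_norm_le_one e
    ((innerSL_apply_norm (𝕜 := ℂ) u).trans_le hu)).transpose
  refine exists_multiplier_of_posSemidef ?_
  convert (posSemidef_one_sub_inner_moebius_mul_kerVec (x := x) p).add (hdiff.hadamard hk)
    using 1
  ext i j
  simp only [Matrix.of_apply, Matrix.add_apply, Matrix.hadamard_apply, Matrix.transpose_apply,
    Matrix.sub_apply, Matrix.gram_apply, Function.comp_apply, innerSL_apply_apply,
    RCLike.inner_apply, e]
  ring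

end Pick

theorem eq_ofReal_of_norm_le_of_le_re {z : ℂ} {r : ℝ} (hz : ‖z‖ ≤ r) (hr : r ≤ z.re) :
    z = (r : ℂ) := by
  have hre : z.re = r := le_antisymm ((Complex.re_le_norm z).trans hz) hr
  have hnorm : ‖z‖ = r := le_antisymm hz (hr.trans (Complex.re_le_norm z))
  have him : z.im = 0 := Complex.abs_re_eq_norm.1 <| by
    rw [hre, hnorm, abs_of_nonneg (hnorm ▸ norm_nonneg z)]
  exact Complex.ext hre him

theorem adjoint_apply_apply_of_norm_le_one {𝕜 H K : Type*} [RCLike 𝕜] [NormedAddCommGroup H]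
    [InnerProductSpace 𝕜 H] [CompleteSpace H] [NormedAddCommGroup K] [InnerProductSpace 𝕜 K]
    [CompleteSpace K] {T : H →L[𝕜] K} (hT : ‖T‖ ≤ 1) {v : H} (hv : ‖T v‖ = ‖v‖) :
    ContinuousLinearMap.adjoint T (T v) = v := by
  have hle : ‖ContinuousLinearMap.adjoint T (T v)‖ ≤ ‖v‖ :=
    calc ‖ContinuousLinearMap.adjoint T (T v)‖ ≤ ‖ContinuousLinearMap.adjoint T‖ * ‖T v‖ :=
          ContinuousLinearMap.le_opNorm _ _
      _ = ‖T‖ * ‖v‖ := by rw [LinearIsometryEquiv.norm_map, hv]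
      _ ≤ ‖v‖ := mul_le_of_le_one_left (norm_nonneg v) hT
  have hsub := norm_sub_sq (𝕜 := 𝕜) (ContinuousLinearMap.adjoint T (T v)) v
  rw [ContinuousLinearMap.adjoint_inner_left, inner_self_eq_norm_sq, hv] at hsub
  have hsq := pow_le_pow_left₀ (norm_nonneg _) hle 2
  rw [← sub_eq_zero, ← norm_eq_zero, ← sq_eq_zero_iff]
  exact le_antisymm (by linarith) (sq_nonneg _)

section TwoPoint

variable {ι : Type*} {n : ℕ} {x : ι → Ball n}

theorem rejection_mem_DASub (i j : ι) : rejection (x i) (x j) ∈ DASub x :=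
  Submodule.sub_mem _ (kerSub x j).2 (Submodule.smul_mem _ _ (kerSub x i).2)

variable [Finite ι]

theorem Multiplier.adjoint_op_rejection {m : Multiplier x} {i : ι} (hi : m.symbol i = 0) (j : ι) :
    ContinuousLinearMap.adjoint m.op ⟨rejection (x i) (x j), rejection_mem_DASub i j⟩ =
      starRingEnd ℂ (m.symbol j) • kerSub x j := by
  have h : (⟨rejection (x i) (x j), rejection_mem_DASub i j⟩ : DASub x) =
      kerSub x j - (kerVec (x j) (x i) / kerVec (x i) (x i)) • kerSub x i := rfl
  rw [h, map_sub, map_smul, m.adjoint_op_kerSub, m.adjoint_op_kerSub, hi, map_zero, zero_smul,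
    smul_zero, sub_zero]

theorem Multiplier.norm_symbol_le_of_symbol_eq_zero {m : Multiplier x} {i : ι}
    (hi : m.symbol i = 0) (j : ι) :
    ‖m.symbol j‖ ≤ ‖m‖ * ‖moebius (x i).1 (x j).1‖ := by
  have h := (ContinuousLinearMap.adjoint m.op).le_opNorm
    ⟨rejection (x i) (x j), rejection_mem_DASub i j⟩
  rw [m.adjoint_op_rejection hi, norm_smul, RCLike.norm_conj, LinearIsometryEquiv.norm_map,
    Submodule.coe_norm, Submodule.coe_norm, norm_rejection, kerSub,
    mul_comm ‖(kerVec (x j) : DA n)‖, ← mul_assoc] at h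
  exact le_of_mul_le_mul_right h (norm_kerVec_pos _)

theorem Multiplier.symbol_mul_conj_of_norm_symbol_eq {m : Multiplier x} (hm : ‖m‖ ≤ 1) {i j : ι}
    (hi : m.symbol i = 0) (hj : ‖m.symbol j‖ = ‖moebius (x i).1 (x j).1‖) (l : ι) :
    m.symbol l * starRingEnd ℂ (m.symbol j) =
      inner ℂ (moebius (x i).1 (x j).1) (moebius (x i).1 (x l).1) := by
  have hT : ‖ContinuousLinearMap.adjoint m.op‖ ≤ 1 :=
    (LinearIsometryEquiv.norm_map _ _).trans_le hm
  have h := adjoint_apply_apply_of_norm_le_one hT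
    (v := ⟨rejection (x i) (x j), rejection_mem_DASub i j⟩) <| by
      rw [m.adjoint_op_rejection hi, norm_smul, RCLike.norm_conj, hj, Submodule.coe_norm,
        Submodule.coe_norm, norm_rejection, kerSub, mul_comm]
  rw [m.adjoint_op_rejection hi, ContinuousLinearMap.adjoint_adjoint] at h
  have hl := congrArg (fun f : DASub x => (f : DA n) (x l)) h
  simp only [m.op_apply, rejection_apply, Submodule.coe_smul, RKHS.coe_smul, Pi.smul_apply,
    smul_eq_mul, kerSub] at hl
  refine mul_right_cancel₀ (kerVec_apply_ne_zero (x j) (x l)) ?_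
  rw [mul_assoc, hl, mul_comm]

theorem exists_multiplier_attaining (hx : Function.Injective x) {i j : ι} (hij : i ≠ j) :
    ∃ m : Multiplier x, ‖m‖ = 1 ∧ ∀ l, m.symbol l =
      inner ℂ (moebius (x i).1 (x j).1) (moebius (x i).1 (x l).1) / ‖moebius (x i).1 (x j).1‖ := by
  have := Fintype.ofFinite ι
  have hpos := norm_moebius_pos hx hij
  set u := moebius (x i).1 (x j).1
  obtain ⟨m, hm, hsymbol⟩ := exists_multiplier_inner_moebius (x := x) (x i)
    (u := (‖u‖ : ℂ)⁻¹ • u) (norm_smul_inv_norm (norm_pos_iff.1 hpos)).le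
  have hsymbol (l : ι) : m.symbol l = inner ℂ u (moebius (x i).1 (x l).1) / ‖u‖ := by
    rw [hsymbol, inner_smul_left, ← Complex.ofReal_inv, Complex.conj_ofReal, Complex.ofReal_inv,
      inv_mul_eq_div]
  refine ⟨m, hm.antisymm ?_, hsymbol⟩
  have h := m.norm_symbol_le_of_symbol_eq_zero (i := i) (by
    rw [hsymbol, moebius_self (x i).norm_lt, inner_zero_right, zero_div]) j
  rw [hsymbol, norm_div, inner_self_eq_ofReal, Complex.norm_real, Complex.norm_real, norm_norm,
    norm_pow, norm_norm, sq, mul_div_cancel_right₀ _ hpos.ne'] at h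
  exact (le_mul_iff_one_le_left hpos).1 h

theorem isExtremal_singleton_iff (hx : Function.Injective x) {i j : ι} (hij : i ≠ j)
    {m : Multiplier x} :
    IsExtremal {i} j m ↔ ∀ l, m.symbol l =
      inner ℂ (moebius (x i).1 (x j).1) (moebius (x i).1 (x l).1) / ‖moebius (x i).1 (x j).1‖ := by
  obtain ⟨m₀, hm₀, hsymbol₀⟩ := exists_multiplier_attaining hx hij
  have hpos := norm_moebius_pos hx hij
  set u := moebius (x i).1 (x j).1
  have hi₀ : m₀.symbol i = 0 := by
    rw [hsymbol₀, moebius_self (x i).norm_lt, inner_zero_right, zero_div]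
  have hj₀ : m₀.symbol j = (‖u‖ : ℂ) := by
    rw [hsymbol₀, inner_self_eq_ofReal, ← Complex.ofReal_div, sq, mul_div_cancel_right₀ _ hpos.ne']
  have hbound {m' : Multiplier x} (h : ‖m'‖ = 1 ∧ ∀ z ∈ ({i} : Set ι), m'.symbol z = 0) :
      ‖m'.symbol j‖ ≤ ‖u‖ := by
    simpa only [h.1, one_mul] using m'.norm_symbol_le_of_symbol_eq_zero (h.2 i rfl) j
  constructor
  · rintro ⟨hm, hmax⟩ l
    have hre := hmax m₀ ⟨hm₀, by rintro _ rfl; exact hi₀⟩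
    rw [hj₀, Complex.ofReal_re] at hre
    have hj := eq_ofReal_of_norm_le_of_le_re (hbound hm) hre
    have hl := m.symbol_mul_conj_of_norm_symbol_eq hm.1.le (hm.2 i rfl)
      (by rw [hj, Complex.norm_real, norm_norm]) l
    rwa [hj, Complex.conj_ofReal, ← eq_div_iff (Complex.ofReal_ne_zero.2 hpos.ne')] at hl
  · intro hsymbol
    obtain rfl : m = m₀ := Multiplier.ext_symbol fun l => by rw [hsymbol, hsymbol₀]
    refine ⟨⟨hm₀, by rintro _ rfl; exact hi₀⟩, fun m' h => ?_⟩
    rw [hj₀, Complex.ofReal_re]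
    exact (Complex.re_le_norm _).trans (hbound h)

theorem existsUnique_isExtremal_singleton (hx : Function.Injective x) {i j : ι} (hij : i ≠ j) :
    ∃! m : Multiplier x, IsExtremal {i} j m := by
  obtain ⟨m, -, hm⟩ := exists_multiplier_attaining hx hij
  refine ⟨m, (isExtremal_singleton_iff hx hij).2 hm, fun m' hm' => ?_⟩
  exact Multiplier.ext_symbol fun l => by rw [hm, (isExtremal_singleton_iff hx hij).1 hm']

theorem IsExtremal.symbol_eq_delta (hx : Function.Injective x) {i j : ι} (hij : i ≠ j)
    {m : Multiplier x} (hm : IsExtremal {i} j m) : m.symbol j = (delta x i j : ℂ) := by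
  rw [(isExtremal_singleton_iff hx hij).1 hm, inner_self_eq_ofReal, ← Complex.ofReal_div, sq,
    mul_div_cancel_right₀ _ (norm_moebius_pos hx hij).ne', delta_eq_norm_moebius]

theorem IsExtremal.symbol_mul_eq_delta_mul_delta (hx : Function.Injective x) {a b c : ι}
    (hba : b ≠ a) (hca : c ≠ a) {m m' : Multiplier x} (hm : IsExtremal {b} a m)
    (hm' : IsExtremal {c} a m') :
    (m * m').symbol a = ((delta x a b * delta x a c : ℝ) : ℂ) := by
  rw [Multiplier.symbol_mul, hm.symbol_eq_delta hx hba, hm'.symbol_eq_delta hx hca,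
    delta_comm x a b, delta_comm x a c, Complex.ofReal_mul]

theorem exists_smul_iff_moebiusCollinear (hx : Function.Injective x) {i j l : ι} (hij : i ≠ j)
    (hil : i ≠ l) {m m' : Multiplier x} (hm : IsExtremal {i} j m) (hm' : IsExtremal {i} l m') :
    (∃ α : ℂ, ‖α‖ = 1 ∧ m = α • m') ↔ MoebiusCollinear (x i).1 (x j).1 (x l).1 := by
  have hl := hm'.symbol_eq_delta hx hil
  rw [delta_eq_norm_moebius] at hl
  rw [isExtremal_singleton_iff hx hij] at hm
  rw [isExtremal_singleton_iff hx hil] at hm'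
  have hu := norm_moebius_pos hx hij
  have hv := norm_moebius_pos hx hil
  rw [MoebiusCollinear]
  set u := moebius (x i).1 (x j).1
  set v := moebius (x i).1 (x l).1
  constructor
  · rintro ⟨α, hα, rfl⟩
    have h := congrArg norm (hm l)
    rw [Multiplier.symbol_smul, hl, norm_mul, hα, one_mul, norm_div, Complex.norm_real,
      Complex.norm_real, norm_norm, norm_norm, eq_div_iff hu.ne', mul_comm] at h
    exact h.symm
  · intro h
    obtain ⟨c, hc, hvc⟩ := (norm_inner_eq_norm_iff (norm_pos_iff.1 hu) (norm_pos_iff.1 hv)).1 h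
    have hc' : starRingEnd ℂ c ≠ 0 := (map_ne_zero _).2 hc
    have hcn : (‖c‖ : ℂ) ≠ 0 := Complex.ofReal_ne_zero.2 (norm_ne_zero_iff.2 hc)
    refine ⟨‖c‖ / starRingEnd ℂ c, ?_, Multiplier.ext_symbol fun z => ?_⟩
    · rw [norm_div, RCLike.norm_conj, Complex.norm_real, norm_norm,
        div_self (norm_ne_zero_iff.2 hc)]
    · rw [Multiplier.symbol_smul, hm, hm', hvc, inner_smul_left, norm_smul, Complex.ofReal_mul]
      field_simp

end TwoPoint

section Lagrange

variable {ι : Type*} {n : ℕ} {x : ι → Ball n}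

variable (x) in
/-- `g` is the Lagrange interpolation function of `X` at `x_a`: the element of `DA_n(X)` which is
`1` at `x_a` and `0` at the other points. -/
def IsLagrange (a : ι) (g : DASub x) : Prop :=
  (g : DA n) (x a) = 1 ∧ ∀ j ≠ a, (g : DA n) (x j) = 0

theorem DASub.smul_apply (c : ℂ) (h : DASub x) (z : Ball n) :
    ((c • h : DASub x) : DA n) z = c * (h : DA n) z := by
  rw [Submodule.coe_smul, RKHS.coe_smul, Pi.smul_apply, smul_eq_mul]

theorem exists_isLagrange [Finite ι] (hx : Function.Injective x) (a : ι) :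
    ∃ g, IsLagrange x a g := by
  classical
  have := Fintype.ofFinite ι
  have hfinset (s : Finset ι) (hs : a ∉ s) :
      ∃ h : DASub x, (h : DA n) (x a) ≠ 0 ∧ ∀ j ∈ s, (h : DA n) (x j) = 0 := by
    induction s using Finset.induction_on with
    | empty =>
      exact ⟨kerSub x a, kerVec_apply_ne_zero _ _, fun _ h => absurd h (Finset.notMem_empty _)⟩
    | insert j s _ ih =>
      rw [Finset.mem_insert, not_or] at hs
      obtain ⟨h, ha, hzero⟩ := ih hs.2
      obtain ⟨m, -, hm⟩ := exists_multiplier_attaining hx (Ne.symm hs.1)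
      have hpos := norm_moebius_pos hx (Ne.symm hs.1)
      refine ⟨m.op h, ?_, fun l hl => ?_⟩
      · rw [m.op_apply, hm]
        exact mul_ne_zero (div_ne_zero (inner_self_ne_zero.2 (norm_pos_iff.1 hpos))
          (Complex.ofReal_ne_zero.2 hpos.ne')) ha
      · rw [m.op_apply]
        obtain rfl | hl := Finset.mem_insert.1 hl
        · rw [hm, moebius_self (x l).norm_lt, inner_zero_right, zero_div, zero_mul]
        · rw [hzero l hl, mul_zero]
  obtain ⟨h, ha, hzero⟩ := hfinset (Finset.univ.erase a) (Finset.notMem_erase a _)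
  refine ⟨((h : DA n) (x a))⁻¹ • h, ?_, fun j hj => ?_⟩
  · rw [DASub.smul_apply, inv_mul_cancel₀ ha]
  · rw [DASub.smul_apply, hzero j (Finset.mem_erase.2 ⟨hj, Finset.mem_univ j⟩), mul_zero]

namespace IsLagrange

variable {a : ι} {g : DASub x}

theorem eq_smul (hg : IsLagrange x a g) {h : DASub x} (hh : ∀ j ≠ a, (h : DA n) (x j) = 0) :
    h = (h : DA n) (x a) • g := by
  refine DASub.ext_apply fun j => ?_
  rw [DASub.smul_apply]
  obtain rfl | hj := eq_or_ne j a
  · rw [hg.1, mul_one]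
  · rw [hh j hj, hg.2 j hj, mul_zero]

theorem norm_pos (hg : IsLagrange x a g) : 0 < ‖g‖ := by
  refine norm_pos_iff.2 fun h => one_ne_zero (α := ℂ) ?_
  rw [← hg.1, ← inner_kerSub, h, inner_zero_right]

theorem norm_mul_norm_kerSub_pos (hg : IsLagrange x a g) : 0 < ‖g‖ * ‖kerSub x a‖ :=
  mul_pos hg.norm_pos (norm_kerSub_pos a)

theorem norm_multiplier (hg : IsLagrange x a g) {m : Multiplier x}
    (hm : ∀ j ≠ a, m.symbol j = 0) : ‖m‖ = ‖m.symbol a‖ * (‖g‖ * ‖kerSub x a‖) := by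
  have hop : m.op = InnerProductSpace.rankOne ℂ (m.symbol a • g) (kerSub x a) := by
    ext1 h
    rw [InnerProductSpace.rankOne_apply, inner_kerSub, hg.eq_smul (h := m.op h) fun j hj => by
      rw [m.op_apply, hm j hj, zero_mul], m.op_apply, mul_comm, mul_smul]
  rw [Multiplier.norm_def, hop, InnerProductSpace.norm_rankOne, norm_smul, mul_assoc]

theorem exists_multiplier (hg : IsLagrange x a g) (c : ℂ) :
    ∃ m : Multiplier x, m.symbol a = c ∧ ∀ j ≠ a, m.symbol j = 0 := by
  refine ⟨⟨fun j => c * (g : DA n) (x j), InnerProductSpace.rankOne ℂ (c • g) (kerSub x a),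
    fun h j => ?_⟩, (congrArg (c * ·) hg.1).trans (mul_one c), fun j hj =>
      (congrArg (c * ·) (hg.2 j hj)).trans (mul_zero c)⟩
  rw [InnerProductSpace.rankOne_apply, inner_kerSub, DASub.smul_apply, DASub.smul_apply]
  obtain rfl | hj := eq_or_ne j a
  · exact mul_comm _ _
  · rw [hg.2 j hj, mul_zero, mul_zero, zero_mul]

theorem exists_multiplier_norm_eq_one (hg : IsLagrange x a g) :
    ∃ m : Multiplier x, ‖m‖ = 1 ∧ m.symbol a = ((‖g‖ * ‖kerSub x a‖)⁻¹ : ℝ) ∧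
      ∀ j ≠ a, m.symbol j = 0 := by
  obtain ⟨m, ha, hzero⟩ := hg.exists_multiplier ((‖g‖ * ‖kerSub x a‖)⁻¹ : ℝ)
  refine ⟨m, ?_, ha, hzero⟩
  have hpos := hg.norm_mul_norm_kerSub_pos
  rw [hg.norm_multiplier hzero, ha, Complex.norm_real, Real.norm_of_nonneg (by positivity),
    inv_mul_cancel₀ hpos.ne']

theorem norm_symbol_le (hg : IsLagrange x a g) {m : Multiplier x} (hm : ‖m‖ ≤ 1)
    (hzero : ∀ j ≠ a, m.symbol j = 0) : ‖m.symbol a‖ ≤ (‖g‖ * ‖kerSub x a‖)⁻¹ := by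
  rwa [hg.norm_multiplier hzero, ← le_div_iff₀ hg.norm_mul_norm_kerSub_pos, one_div] at hm

theorem isExtremal_compl_singleton_iff (hg : IsLagrange x a g) {m : Multiplier x} :
    IsExtremal {a}ᶜ a m ↔
      m.symbol a = ((‖g‖ * ‖kerSub x a‖)⁻¹ : ℝ) ∧ ∀ j ≠ a, m.symbol j = 0 := by
  obtain ⟨m₀, hm₀, ha₀, hzero₀⟩ := hg.exists_multiplier_norm_eq_one
  constructor
  · rintro ⟨hm, hmax⟩
    have hre := hmax m₀ ⟨hm₀, hzero₀⟩
    rw [ha₀, Complex.ofReal_re] at hre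
    exact ⟨eq_ofReal_of_norm_le_of_le_re (hg.norm_symbol_le hm.1.le hm.2) hre, hm.2⟩
  · rintro ⟨ha, hzero⟩
    refine ⟨⟨?_, hzero⟩, fun m' h => ?_⟩
    · rw [hg.norm_multiplier hzero, ha, ← ha₀, ← hg.norm_multiplier hzero₀, hm₀]
    · rw [ha, Complex.ofReal_re]
      exact (Complex.re_le_norm _).trans (hg.norm_symbol_le h.1.le h.2)

theorem existsUnique_isExtremal (hg : IsLagrange x a g) :
    ∃! m : Multiplier x, IsExtremal {a}ᶜ a m := by
  obtain ⟨m, -, ha, hzero⟩ := hg.exists_multiplier_norm_eq_one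
  refine ⟨m, hg.isExtremal_compl_singleton_iff.2 ⟨ha, hzero⟩, fun m' hm' => ?_⟩
  obtain ⟨ha', hzero'⟩ := hg.isExtremal_compl_singleton_iff.1 hm'
  refine Multiplier.ext_symbol fun j => ?_
  obtain rfl | hj := eq_or_ne j a
  · rw [ha, ha']
  · rw [hzero j hj, hzero' j hj]

variable {b c : ι}

theorem deltaG_eq (hg : IsLagrange x a g) (hbc : ({b, c} : Set ι) = {a}ᶜ) :
    DeltaG x a b c = (‖g‖ * ‖kerSub x a‖)⁻¹ := by
  have hne : ∀ j ≠ a, j = b ∨ j = c := fun j hj => hbc.symm.subset hj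
  refine IsGreatest.csSup_eq ⟨?_, ?_⟩
  · obtain ⟨m, hm, ha, hzero⟩ := hg.exists_multiplier_norm_eq_one
    exact ⟨m, hzero b (hbc.subset (.inl rfl)), hzero c (hbc.subset (.inr rfl)), hm.le,
      by rw [ha, Complex.ofReal_re]⟩
  · rintro _ ⟨m, hb, hc, hm, rfl⟩
    exact (Complex.re_le_norm _).trans <| hg.norm_symbol_le hm fun j hj => by
      obtain rfl | rfl := hne j hj <;> assumption

theorem deltaH_eq (hg : IsLagrange x a g) (hbc : ({b, c} : Set ι) = {a}ᶜ) :
    DeltaH x a b c = (‖g‖ * ‖kerSub x a‖)⁻¹ := by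
  have hne : ∀ j ≠ a, j = b ∨ j = c := fun j hj => hbc.symm.subset hj
  have hsup : IsGreatest {r | ∃ h : DASub x, (h : DA n) (x b) = 0 ∧ (h : DA n) (x c) = 0 ∧
      ‖h‖ ≤ 1 ∧ r = ((h : DA n) (x a)).re} ‖g‖⁻¹ := by
    constructor
    · refine ⟨(‖g‖ : ℂ)⁻¹ • g, ?_, ?_, ?_, ?_⟩
      · rw [DASub.smul_apply, hg.2 b (hbc.subset (.inl rfl)), mul_zero]
      · rw [DASub.smul_apply, hg.2 c (hbc.subset (.inr rfl)), mul_zero]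
      · rw [norm_smul, norm_inv, Complex.norm_real, norm_norm, inv_mul_cancel₀ hg.norm_pos.ne']
      · rw [DASub.smul_apply, hg.1, mul_one, ← Complex.ofReal_inv, Complex.ofReal_re]
    · rintro _ ⟨h, hb, hc, hh, rfl⟩
      rw [hg.eq_smul (h := h) fun j hj => by obtain rfl | rfl := hne j hj <;> assumption,
        norm_smul, ← le_div_iff₀ hg.norm_pos, one_div] at hh
      exact (Complex.re_le_norm _).trans hh
  rw [DeltaH, hsup.csSup_eq, mul_inv_rev, one_div]
  rfl

end IsLagrange

end Lagrange

theorem norm_sq_mul_det_gram {𝕜 H ι : Type*} [RCLike 𝕜] [NormedAddCommGroup H]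
    [InnerProductSpace 𝕜 H] [Fintype ι] [DecidableEq ι] {v : ι → H} {g : H}
    (hg : g ∈ Submodule.span 𝕜 (Set.range v)) {a : ι}
    (hv : ∀ j, inner 𝕜 (v j) g = Pi.single (M := fun _ => 𝕜) a 1 j) :
    (‖g‖ : 𝕜) ^ 2 * (Matrix.gram 𝕜 v).det = (Matrix.gram 𝕜 v).adjugate a a := by
  obtain ⟨c, hc⟩ := (Submodule.mem_span_range_iff_exists_fun 𝕜).1 hg
  have hmul : (Matrix.gram 𝕜 v).mulVec c = Pi.single a 1 := by
    ext j
    rw [← hv j, ← hc, inner_sum]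
    exact Finset.sum_congr rfl fun i _ => (mul_comm _ _).trans (inner_smul_right _ _ _).symm
  have hcoeff : (‖g‖ : 𝕜) ^ 2 = c a := by
    have hconj : inner 𝕜 g g = starRingEnd 𝕜 (c a) := by
      nth_rw 1 [← hc]
      simp only [sum_inner, inner_smul_left, hv, Pi.single_apply, mul_ite, mul_one, mul_zero,
        Finset.sum_ite_eq', Finset.mem_univ, if_true]
    rw [← inner_self_eq_norm_sq_to_K, ← inner_conj_symm, hconj, RingHomCompTriple.comp_apply,
      RingHom.id_apply]
  have hadj := congrArg (fun w => (Matrix.gram 𝕜 v).adjugate.mulVec w a) hmul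
  simp only [Matrix.mulVec_mulVec, Matrix.adjugate_mul, Matrix.smul_mulVec, Matrix.one_mulVec,
    Matrix.mulVec_single_one, Pi.smul_apply, smul_eq_mul, Matrix.col_apply] at hadj
  rw [hcoeff, mul_comm, hadj]

section ThreePoint

variable {n : ℕ} {x : Fin 3 → Ball n}

theorem det_gram_kerVec :
    (Matrix.gram ℂ fun i => (kerVec (x i) : DA n)).det = kerVec (x 0) (x 0) *
      (kerVec (x 1) (x 1) * kerVec (x 2) (x 2) *
        (inner ℂ (moebius (x 0).1 (x 1).1) (moebius (x 0).1 (x 1).1) *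
          inner ℂ (moebius (x 0).1 (x 2).1) (moebius (x 0).1 (x 2).1)) -
      kerVec (x 1) (x 2) * kerVec (x 2) (x 1) *
        (inner ℂ (moebius (x 0).1 (x 1).1) (moebius (x 0).1 (x 2).1) *
          inner ℂ (moebius (x 0).1 (x 2).1) (moebius (x 0).1 (x 1).1))) := by
  have h (i j : Fin 3) := kerVec_apply_ne_zero (x i) (x j)
  have h00 := h 0 0
  have h11 := h 1 1
  have h22 := h 2 2
  have h12 := h 1 2
  have h21 := h 2 1
  simp only [inner_moebius_moebius, Matrix.det_fin_three, Matrix.gram_apply, inner_kerVec]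
  field_simp
  ring

theorem IsLagrange.norm_sq_mul_eq {g : DASub x} (hg : IsLagrange x 0 g) :
    (‖g‖ * ‖kerSub x 0‖) ^ 2 *
      ((‖moebius (x 0).1 (x 1).1‖ * ‖moebius (x 0).1 (x 2).1‖) ^ 2 -
        (1 - ‖moebius (x 1).1 (x 2).1‖ ^ 2) *
          ‖inner ℂ (moebius (x 0).1 (x 1).1) (moebius (x 0).1 (x 2).1)‖ ^ 2) =
      ‖moebius (x 1).1 (x 2).1‖ ^ 2 := by
  have hdet := norm_sq_mul_det_gram (𝕜 := ℂ) (v := fun i => (kerVec (x i) : DA n)) g.2 (a := 0)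
    fun j => by
      rw [inner_kerVec]
      obtain rfl | hj := eq_or_ne j 0
      · rw [hg.1, Pi.single_eq_same]
      · rw [hg.2 j hj, Pi.single_eq_of_ne hj]
  have hadj : (Matrix.gram ℂ fun i => (kerVec (x i) : DA n)).adjugate 0 0 =
      kerVec (x 1) (x 1) * kerVec (x 2) (x 2) - kerVec (x 2) (x 1) * kerVec (x 1) (x 2) := by
    simp only [Matrix.adjugate_fin_three, Matrix.of_apply, Matrix.cons_val_zero,
      Matrix.gram_apply, inner_kerVec]
  have h12 := inner_moebius_moebius (x 1) (x 2) (x 2)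
  have h11 := kerVec_apply_ne_zero (x 1) (x 1)
  have h22 := kerVec_apply_ne_zero (x 2) (x 2)
  rw [eq_sub_iff_add_eq, ← eq_sub_iff_add_eq', div_eq_iff (mul_ne_zero h11 h22)] at h12
  have h00 : kerVec (x 0) (x 0) = ((‖kerSub x 0‖ ^ 2 : ℝ) : ℂ) := kerVec_apply_self _
  have hcomm (u w : EuclideanSpace ℂ (Fin n)) :
      inner ℂ u w * inner ℂ w u = ((‖inner ℂ u w‖ ^ 2 : ℝ) : ℂ) := by
    rw [← inner_conj_symm w u, Complex.mul_conj', Complex.ofReal_pow]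
  rw [hadj, det_gram_kerVec, mul_comm (kerVec (x 1) (x 2)), h12, hcomm, h00] at hdet
  simp only [inner_self_eq_ofReal, Submodule.norm_coe] at hdet
  refine Complex.ofReal_injective (mul_left_cancel₀ (mul_ne_zero h11 h22) ?_)
  push_cast at hdet ⊢
  linear_combination hdet

theorem IsLagrange.delta_mul_delta_mul_eq_one_iff (hx : Function.Injective x) {g : DASub x}
    (hg : IsLagrange x 0 g) :
    delta x 0 1 * delta x 0 2 * (‖g‖ * ‖kerSub x 0‖) = 1 ↔
      MoebiusCollinear (x 0).1 (x 1).1 (x 2).1 := by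
  have h := hg.norm_sq_mul_eq
  have hd := norm_moebius_pos hx (by decide : (1 : Fin 3) ≠ 2)
  have hd' := norm_moebius_lt_one (x 1).norm_lt (x 2).norm_lt
  have hN := hg.norm_mul_norm_kerSub_pos
  rw [delta_eq_norm_moebius, delta_eq_norm_moebius, MoebiusCollinear]
  set N := ‖g‖ * ‖kerSub x 0‖
  set U := ‖moebius (x 0).1 (x 1).1‖ * ‖moebius (x 0).1 (x 2).1‖
  set d := ‖moebius (x 1).1 (x 2).1‖
  have hU : 0 ≤ U := by positivity
  have hr : 1 - d ^ 2 ≠ 0 := by nlinarith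
  rw [← pow_left_inj₀ (norm_nonneg _) hU two_ne_zero]
  constructor
  · intro hUN
    refine mul_left_cancel₀ (mul_ne_zero hr (pow_pos hN 2).ne') ?_
    linear_combination (-1 : ℝ) * h + d ^ 2 * (U * N + 1) * hUN
  · intro hP
    have hsq : (U * N) ^ 2 = 1 ^ 2 := by
      refine mul_left_cancel₀ (pow_pos hd 2).ne' ?_
      rw [hP] at h
      linear_combination h
    exact (pow_left_inj₀ (by positivity) zero_le_one two_ne_zero).1 hsq

end ThreePoint

section Triple

variable {n : ℕ} {x : Fin 3 → Ball n} {m₂ m₃ m₂₃ : Multiplier x}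

theorem pair_one_two_eq_compl : ({1, 2} : Set (Fin 3)) = {0}ᶜ := by
  ext j
  fin_cases j <;> simp

theorem IsExtremal.symbol_mul_eq_zero (hm₂ : IsExtremal {1} 0 m₂) (hm₃ : IsExtremal {2} 0 m₃) :
    ∀ j ≠ 0, (m₂ * m₃).symbol j = 0 := fun j hj => by
  rw [Multiplier.symbol_mul]
  obtain rfl | rfl := pair_one_two_eq_compl.symm.subset hj
  · rw [hm₂.1.2 1 rfl, zero_mul]
  · rw [hm₃.1.2 2 rfl, mul_zero]

variable {g : DASub x}

theorem IsLagrange.norm_mul_eq_one_iff (hx : Function.Injective x) (hg : IsLagrange x 0 g)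
    (hm₂ : IsExtremal {1} 0 m₂) (hm₃ : IsExtremal {2} 0 m₃) :
    ‖m₂ * m₃‖ = 1 ↔ MoebiusCollinear (x 0).1 (x 1).1 (x 2).1 := by
  have hnonneg : 0 ≤ delta x 0 1 * delta x 0 2 :=
    mul_nonneg (Real.sqrt_nonneg _) (Real.sqrt_nonneg _)
  rw [hg.norm_multiplier (hm₂.symbol_mul_eq_zero hm₃),
    hm₂.symbol_mul_eq_delta_mul_delta hx (by decide) (by decide) hm₃, Complex.norm_real,
    Real.norm_of_nonneg hnonneg, hg.delta_mul_delta_mul_eq_one_iff hx]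

theorem IsLagrange.inv_eq_delta_mul_delta_iff (hx : Function.Injective x)
    (hg : IsLagrange x 0 g) :
    (‖g‖ * ‖kerSub x 0‖)⁻¹ = delta x 0 1 * delta x 0 2 ↔
      MoebiusCollinear (x 0).1 (x 1).1 (x 2).1 := by
  rw [inv_eq_one_div, div_eq_iff hg.norm_mul_norm_kerSub_pos.ne', eq_comm,
    hg.delta_mul_delta_mul_eq_one_iff hx]

theorem IsLagrange.eq_mul_iff (hx : Function.Injective x) (hg : IsLagrange x 0 g)
    (hm₂ : IsExtremal {1} 0 m₂) (hm₃ : IsExtremal {2} 0 m₃) (hm₂₃ : IsExtremal {1, 2} 0 m₂₃) :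
    m₂₃ = m₂ * m₃ ↔ MoebiusCollinear (x 0).1 (x 1).1 (x 2).1 := by
  rw [pair_one_two_eq_compl, hg.isExtremal_compl_singleton_iff] at hm₂₃
  rw [← hg.inv_eq_delta_mul_delta_iff hx, ← Complex.ofReal_inj, ← hm₂₃.1,
    ← hm₂.symbol_mul_eq_delta_mul_delta hx (by decide) (by decide) hm₃]
  refine ⟨fun h => h ▸ rfl, fun h => Multiplier.ext_symbol fun j => ?_⟩
  obtain rfl | hj := eq_or_ne j 0
  · exact h
  · rw [hm₂₃.2 j hj, hm₂.symbol_mul_eq_zero hm₃ j hj]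

end Triple

end DruryArveson

end

theorem proposition6p6 {n : ℕ} (y : Fin 3 → Ball n) (hy : Function.Injective y) :
    (∃! x : Fin 3 → Ball 2, IsNormalFormOf x y) ∧
    ∀ x : Fin 3 → Ball 2, IsNormalFormOf x y →
      (∃! M₂ : Multiplier x, IsExtremal {0} 1 M₂) ∧
      (∃! M₃ : Multiplier x, IsExtremal {0} 2 M₃) ∧
      (∃! m₂ : Multiplier x, IsExtremal {1} 0 m₂) ∧
      (∃! m₃ : Multiplier x, IsExtremal {2} 0 m₃) ∧
      (∃! m₂₃ : Multiplier x, IsExtremal {1, 2} 0 m₂₃) ∧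
      ∀ M₂ M₃ m₂ m₃ m₂₃ : Multiplier x,
        IsExtremal {0} 1 M₂ → IsExtremal {0} 2 M₃ →
        IsExtremal {1} 0 m₂ → IsExtremal {2} 0 m₃ → IsExtremal {1, 2} 0 m₂₃ →
        List.TFAE
          [∃ G : Set (Ball n), IsComplexGeodesic G ∧ ∀ j, y j ∈ G,
           ClassE x,
           LFsq x 0 1 2 = delta x 0 2 ^ 2,
           ∃ α : ℂ, ‖α‖ = 1 ∧ M₂ = α • M₃,
           m₂₃ = m₂ * m₃,
           ‖m₂ * m₃‖ = 1,
           DeltaG x 0 1 2 = delta x 0 1 * delta x 0 2,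
           DeltaH x 0 1 2 = delta x 0 1 * delta x 0 2] := by
  refine ⟨existsUnique_isNormalFormOf y hy, fun x h => ?_⟩
  have hx := h.injective hy
  obtain ⟨g, hg⟩ := exists_isLagrange hx 0
  refine ⟨existsUnique_isExtremal_singleton hx (by decide),
    existsUnique_isExtremal_singleton hx (by decide),
    existsUnique_isExtremal_singleton hx (by decide),
    existsUnique_isExtremal_singleton hx (by decide),
    pair_one_two_eq_compl ▸ hg.existsUnique_isExtremal,
    fun M₂ M₃ m₂ m₃ m₂₃ hM₂ hM₃ hm₂ hm₃ hm₂₃ => ?_⟩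
  refine List.tfae_of_forall (MoebiusCollinear (x 0).1 (x 1).1 (x 2).1) _ ?_
  simp only [List.forall_mem_cons]
  exact ⟨h.exists_isComplexGeodesic_iff.trans h.1.classE_iff,
    h.1.classE_iff,
    LFsq_eq_delta_sq_iff hx (by decide),
    exists_smul_iff_moebiusCollinear hx (by decide) (by decide) hM₂ hM₃,
    hg.eq_mul_iff hx hm₂ hm₃ hm₂₃,
    hg.norm_mul_eq_one_iff hx hm₂ hm₃,
    hg.deltaG_eq pair_one_two_eq_compl ▸ hg.inv_eq_delta_mul_delta_iff hx,
    hg.deltaH_eq pair_one_two_eq_compl ▸ hg.inv_eq_delta_mul_delta_iff hx,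
    List.forall_mem_nil _⟩
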